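/- Setting. Let $A$ be a positive self-adjoint operator on the real Hilbert space $H=L^2(\mathbb R,dt)$ with $\inf\sigma(A)>1$ and Hilbert–Schmidt inverse. Let $E=\bigcap_{p}\mathrm{dom}(A^p)$ with the norms $|\xi|_p=|A^p\xi|_0$, let $E^*$ be its topological dual and $E_{\mathbb C}$ its complexification; let $E_{\mathbb C}^{\otimes n}$ be the completed tensor power with the norms $|f|_p=|(A^{p})^{\otimes n}f|_0$, and let the index "sym" denote symmetric elements. Let $\tau\in(E_{\mathbb C}^{\otimes 2})^*$ be the trace, $\langle\tau,\xi\otimes\eta\rangle=\langle\xi,\eta\rangle$, and for $x\in E^*$ let $$:x^{\otimes n}:\;=\sum_{k=0}^{\lfloor n/2\rfloor}\binom{n}{2k}(2k-1)!!\,(-1)^k\,x^{\otimes(n-2k)}\,\widehat\otimes\,\tau^{\otimes k}$$ be the Wick ordering of $x^{\otimes n}$. For $0\le\beta<1$ let $(E)_\beta$ be the space of all sequences $\varphi\sim(f_n)_{n\ge0}$, $f_n\in(E_{\mathbb C}^{\otimes n})_{sym}$, with $|\varphi|_{p,\beta}^2=\sum_n (n!)^{1+\beta}|f_n|_p^2<\infty$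 for all $p$, topologized by these norms; $\varphi$ is regarded as the function $\varphi(x)=\sum_n\langle:x^{\otimes n}:,f_n\rangle$ on $E^*$. Write $(E)=(E)_0$. For $\kappa\in(E_{\mathbb C}^{\otimes r})^*_{sym}$ let $$\Xi_{0,r}(\kappa)\varphi=\sum_{n=0}^\infty\frac{(n+r)!}{n!}\langle:x^{\otimes n}:,\kappa\otimes_r f_{n+r}\rangle ,$$ where $\otimes_r$ is the contraction of $r$ tensor factors, put $\Delta_G=\Xi_{0,2}(\tau)$, and for $x\in E^*$, $r\ge1$ let $$:x^{\otimes n}:_{\kappa}\;=\sum_{k=0}^{\lfloor n/r\rfloor}\frac{n!}{(n-rk)!\,k!}\Big(-\frac12\Big)^k x^{\otimes(n-rk)}\,\widehat\otimes\,\kappa^{\widehat\otimes k}.$$ For $\zeta\in E_{\mathbb C}$ let $\Phi_\zeta\sim(\zeta^{\otimes n}/n!)_n$. Proposition. (i) Let $r\ge1$, $\kappa_{0,r}\in(E_{\mathbb C}^{\otimes r})^*_{sym}$ and $\frac{\max(0,r-2)}{r}\le\beta<1$. Then $\Xi_{0,r}(\kappa_{0,r})$ is a continuous linear operator on $(E)_\beta$,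 the series $\exp(-\frac12\Xi_{0,r}(\kappa_{0,r}))=\sum_n\frac1{n!}(-\frac12\Xi_{0,r}(\kappa_{0,r}))^n$ converges in $L((E)_\beta,(E)_\beta)$ for the topology of uniform convergence on bounded sets, and for all $m\ge0$ and $f_m\in(E_{\mathbb C}^{\otimes m})_{sym}$ the function $x\mapsto\langle x^{\otimes m},f_m\rangle$ is the function of exactly one element of $(E)_\beta$ and $$\exp\!\big(-\tfrac12\Xi_{0,r}(\kappa_{0,r})\big)\langle x^{\otimes m},f_m\rangle=\langle:x^{\otimes m}:_{\kappa_{0,r}},f_m\rangle .$$ (ii) For $r=2$ and $\kappa=\tau$ this is ordinary Wick ordering: $:x^{\otimes m}:_\tau\;=\;:x^{\otimes m}:$ for all $x\in E^*$, $m\ge0$; moreover $e^{\langle\cdot,\zeta\rangle}\in(E)$ for all $\zeta\in E_{\mathbb C}$, there is exactly one $\Theta\in L((E),(E))$ with $\Theta(e^{\langle\cdot,\zeta\rangle})=\Phi_\zeta$ for all $\zeta\in E_{\mathbb C}$ (the renormalization operator), one has $\Theta=\exp(-\frac12\Delta_G)$, and $\Theta\langle x^{\otimes m},f_m\rangle=\langle:x^{\otimes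 m}:,f_m\rangle$ for all $f_m\in(E_{\mathbb C}^{\otimes m})_{sym}$. -/

import Mathlib

open MeasureTheory
open scoped NNReal

noncomputable section

namespace WhiteNoise

/-! ### The operator `A` on the real Hilbert space `L²(ℝ, dt)` -/

/-- The real Hilbert space `H = L²(ℝ, dt)`. -/
abbrev RealL2 : Type := Lp ℝ 2 (volume : Measure ℝ)

/-- The bounded operator `R` is the two-sided inverse of `A - z`, with values in the domain. -/
structure IsResolventAt (A : RealL2 →ₗ.[ℝ] RealL2) (z : ℝ) (R : RealL2 →L[ℝ] RealL2) : Prop where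
  mem_domain : ∀ h, R h ∈ A.domain
  right_inv : ∀ h, A ⟨R h, mem_domain h⟩ - z • R h = h
  left_inv : ∀ ξ : A.domain, R (A ξ - z • (ξ : RealL2)) = ξ

/-- The (real) spectrum of an unbounded operator; for a self-adjoint operator the whole spectrum
of its complexification is real. -/
def spectrumOf (A : RealL2 →ₗ.[ℝ] RealL2) : Set ℝ :=
  {z | ¬ ∃ R : RealL2 →L[ℝ] RealL2, IsResolventAt A z R}

/-- `A` is a positive self-adjoint operator on `L²(ℝ, dt)` with `inf σ(A) > 1` and with a
Hilbert-Schmidt inverse. (Self-adjointness contains that the domain is dense.) -/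
structure IsWhiteNoiseOperator (A : RealL2 →ₗ.[ℝ] RealL2) : Prop where
  selfAdjoint : IsSelfAdjoint A
  positive : ∀ ξ : A.domain, 0 ≤ inner ℝ (A ξ) (ξ : RealL2)
  one_lt_inf_spectrum : ∃ c : ℝ, 1 < c ∧ ∀ z ∈ spectrumOf A, c ≤ z
  hilbertSchmidt_inverse : ∃ R : RealL2 →L[ℝ] RealL2, IsResolventAt A 0 R ∧
    ∃ b : HilbertBasis ℕ ℝ RealL2, Summable fun i => ‖R (b i)‖ ^ 2

/-- An orthonormal basis of `L²(ℝ, dt)` made of eigenvectors of `A`. It serves to write down the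
powers `A ^ p` and the tensor powers in coordinates. -/
structure Eigenbasis (A : RealL2 →ₗ.[ℝ] RealL2) where
  ι : Type
  e : HilbertBasis ι ℝ RealL2
  lam : ι → ℝ
  mem_domain : ∀ j, e j ∈ A.domain
  apply_eq : ∀ j, A ⟨e j, mem_domain j⟩ = lam j • e j
  one_lt : ∃ c : ℝ, 1 < c ∧ ∀ j, c ≤ lam j
  summable_inv_sq : Summable fun j => (lam j ^ 2)⁻¹

/-! ### Weighted sequence spaces -/

section Koethe

variable (𝕜 : Type) [RCLike 𝕜] {α : Type} (w : ℕ → α → ℝ)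

theorem memlp_two_iff {f : α → 𝕜} (v : α → ℝ) :
    Memℓp (fun a => (v a : 𝕜) * f a) 2 ↔ Summable fun a => (v a * ‖f a‖) ^ 2 := by
  rw [memℓp_gen_iff (by norm_num)]
  refine summable_congr fun a => ?_
  simp [mul_pow]

/-- Families `f` with `∑ₐ (w p a ‖f a‖)² < ∞` for all `p`. -/
def koetheSubmodule : Submodule 𝕜 (α → 𝕜) where
  carrier := {f | ∀ p, Summable fun a => (w p a * ‖f a‖) ^ 2}
  add_mem' := by
    intro f g hf hg p
    rw [← memlp_two_iff]
    have := ((memlp_two_iff 𝕜 (w p)).2 (hf p)).add ((memlp_two_iff 𝕜 (w p)).2 (hg p))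
    convert this using 1
    funext a
    simp [mul_add]
  zero_mem' := by
    intro p
    simp
  smul_mem' := by
    intro c f hf p
    rw [← memlp_two_iff]
    have := ((memlp_two_iff 𝕜 (w p)).2 (hf p)).const_smul c
    convert this using 1
    funext a
    simp [mul_left_comm]

/-- The space of all families `f` with `∑ₐ (w p a ‖f a‖)² < ∞` for all `p`, a countably Hilbert
space for the norms `(∑ₐ (w p a ‖f a‖)²)^½`. (A type of its own: the subtype of `α → 𝕜` would carry
the topology of pointwise convergence.) -/
def Koethe : Type := koetheSubmodule 𝕜 w

instance : AddCommGroup (Koethe 𝕜 w) := inferInstanceAs (AddCommGroup (koetheSubmodule 𝕜 w))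

instance : Module 𝕜 (Koethe 𝕜 w) := inferInstanceAs (Module 𝕜 (koetheSubmodule 𝕜 w))

instance : FunLike (Koethe 𝕜 w) α 𝕜 where
  coe f := Subtype.val (p := fun f => f ∈ koetheSubmodule 𝕜 w) f
  coe_injective := Subtype.val_injective

variable {𝕜 w}

/-- A family with finite norms, as an element of the space. -/
def Koethe.mk (f : α → 𝕜) (hf : ∀ p, Summable fun a => (w p a * ‖f a‖) ^ 2) : Koethe 𝕜 w :=
  (⟨f, hf⟩ : koetheSubmodule 𝕜 w)

@[simp] theorem Koethe.mk_apply (f : α → 𝕜) (hf : ∀ p, Summable fun a => (w p a * ‖f a‖) ^ 2)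
    (a : α) : Koethe.mk (w := w) f hf a = f a := rfl

theorem Koethe.summable (f : Koethe 𝕜 w) (p : ℕ) : Summable fun a => (w p a * ‖f a‖) ^ 2 :=
  Subtype.property (p := fun f => f ∈ koetheSubmodule 𝕜 w) f p

@[ext] theorem Koethe.ext {f g : Koethe 𝕜 w} (h : ∀ a, f a = g a) : f = g := DFunLike.ext f g h

@[simp] theorem Koethe.add_apply (f g : Koethe 𝕜 w) (a : α) : (f + g) a = f a + g a := rfl

@[simp] theorem Koethe.smul_apply (c : 𝕜) (f : Koethe 𝕜 w) (a : α) : (c • f) a = c * f a := rfl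

variable (𝕜 w)

/-- The weighted family as an element of `ℓ²`. -/
def Koethe.toLp (p : ℕ) : Koethe 𝕜 w →ₗ[𝕜] lp (fun _ : α => 𝕜) 2 where
  toFun f := ⟨fun a => (w p a : 𝕜) * f a, (memlp_two_iff 𝕜 (w p)).2 (f.summable p)⟩
  map_add' f g := by
    ext a
    exact mul_add _ _ _
  map_smul' c f := by
    ext a
    simp [mul_left_comm]

/-- The norms `|f|_p = (∑ₐ (w p a ‖f a‖)²)^½`. -/
def Koethe.norms : SeminormFamily 𝕜 (Koethe 𝕜 w) ℕ := fun p =>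
  (normSeminorm 𝕜 (lp (fun _ : α => 𝕜) 2)).comp (Koethe.toLp 𝕜 w p)

instance : TopologicalSpace (Koethe 𝕜 w) := (Koethe.norms 𝕜 w).moduleFilterBasis.topology

theorem Koethe.withSeminorms : WithSeminorms (Koethe.norms 𝕜 w) := ⟨rfl⟩

instance : IsTopologicalAddGroup (Koethe 𝕜 w) := (Koethe.withSeminorms 𝕜 w).topologicalAddGroup

instance : ContinuousSMul 𝕜 (Koethe 𝕜 w) := (Koethe.withSeminorms 𝕜 w).continuousSMul

variable {𝕜 w}

theorem Koethe.norms_sq (p : ℕ) (f : Koethe 𝕜 w) :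
    Koethe.norms 𝕜 w p f ^ 2 = ∑' a, (w p a * ‖f a‖) ^ 2 := by
  have h := lp.norm_rpow_eq_tsum (p := 2) (by norm_num) (Koethe.toLp 𝕜 w p f)
  have h' : Koethe.norms 𝕜 w p f = ‖Koethe.toLp 𝕜 w p f‖ := rfl
  rw [h']
  simp only [ENNReal.toReal_ofNat, Real.rpow_ofNat] at h
  rw [h]
  refine tsum_congr fun a => ?_
  simp [Koethe.toLp, mul_pow]

theorem Koethe.norms_mono (hw : ∀ p a, 0 ≤ w p a) (hm : ∀ p q, p ≤ q → ∀ a, w p a ≤ w q a)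
    {p q : ℕ} (hpq : p ≤ q) : Koethe.norms 𝕜 w p ≤ Koethe.norms 𝕜 w q := by
  intro f
  refine (pow_le_pow_iff_left₀ (apply_nonneg _ _) (apply_nonneg _ _) two_ne_zero).1 ?_
  rw [Koethe.norms_sq, Koethe.norms_sq]
  refine (f.summable p).tsum_le_tsum (fun a => ?_) (f.summable q)
  have := hw p a
  have := hm p q hpq a
  gcongr

theorem exists_bound {V : Type} [AddCommGroup V] [Module 𝕜 V] [TopologicalSpace V]
    {N : SeminormFamily 𝕜 V ℕ} (hN : WithSeminorms N) (hm : Monotone N) (κ : V →L[𝕜] 𝕜) :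
    ∃ (q : ℕ) (C : ℝ), 0 ≤ C ∧ ∀ f, ‖κ f‖ ≤ C * N q f := by
  obtain ⟨s, C, -, h⟩ := Seminorm.bound_of_continuous hN
    ((normSeminorm 𝕜 𝕜).comp (κ : V →ₗ[𝕜] 𝕜)) (continuous_norm.comp κ.continuous)
  refine ⟨s.sup id, C, C.2, fun f => ?_⟩
  have h1 : s.sup N ≤ N (s.sup id) := Finset.sup_le fun i hi => hm (Finset.le_sup (f := id) hi)
  exact (h f).trans (mul_le_mul_of_nonneg_left (h1 f) C.2)

theorem Koethe.continuous_of_bound {β : Type} {v : ℕ → β → ℝ}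
    (T : Koethe 𝕜 w →ₗ[𝕜] Koethe 𝕜 v)
    (h : ∀ p, ∃ (q : ℕ) (C : ℝ), 0 ≤ C ∧
      ∀ f, Koethe.norms 𝕜 v p (T f) ≤ C * Koethe.norms 𝕜 w q f) : Continuous T := by
  refine WithSeminorms.continuous_of_isBounded (Koethe.withSeminorms 𝕜 w)
    (Koethe.withSeminorms 𝕜 v) T ?_
  intro p
  obtain ⟨q, C, hC, h⟩ := h p
  refine ⟨{q}, ⟨C, hC⟩, fun f => ?_⟩
  rw [Finset.sup_singleton]
  exact h f

theorem summable_mul_and_le {a b : α → ℝ} (ha : ∀ i, 0 ≤ a i) (hb : ∀ i, 0 ≤ b i)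
    (hsa : Summable fun i => a i ^ 2) (hsb : Summable fun i => b i ^ 2) :
    Summable (fun i => a i * b i) ∧
      ∑' i, a i * b i ≤ √(∑' i, a i ^ 2) * √(∑' i, b i ^ 2) := by
  have := Real.summable_and_inner_le_Lp_mul_Lq_tsum_of_nonneg
    (Real.HolderConjugate.two_two) ha hb (by simpa using hsa) (by simpa using hsb)
  simpa [Real.sqrt_eq_rpow] using this

theorem Koethe.pairing_aux {c : α → 𝕜} {p : ℕ} (hw : ∀ a, 0 < w p a)
    (hc : Summable fun a => ((w p a)⁻¹ * ‖c a‖) ^ 2) (f : Koethe 𝕜 w) :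
    Summable (fun a => c a * f a) ∧
      ‖∑' a, c a * f a‖ ≤ √(∑' a, ((w p a)⁻¹ * ‖c a‖) ^ 2) * Koethe.norms 𝕜 w p f := by
  have hn : ∀ a, ‖c a * f a‖ = ((w p a)⁻¹ * ‖c a‖) * (w p a * ‖f a‖) := fun a => by
    have := (hw a).ne'
    rw [norm_mul]
    field_simp
  obtain ⟨h1, h2⟩ := summable_mul_and_le
    (a := fun a => (w p a)⁻¹ * ‖c a‖) (b := fun a => w p a * ‖f a‖)
    (fun a => by have := hw a; positivity) (fun a => by have := hw a; positivity) hc (f.summable p)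
  have h3 : Summable fun a => ‖c a * f a‖ := h1.congr fun a => (hn a).symm
  refine ⟨h3.of_norm, (norm_tsum_le_tsum_norm h3).trans ?_⟩
  rw [← Koethe.norms_sq, Real.sqrt_sq (apply_nonneg _ _)] at h2
  exact (tsum_congr hn).le.trans h2

/-- The continuous functional `f ↦ ∑ₐ c a f a` with coefficients `c` in some dual weighted `ℓ²`. -/
def Koethe.pairing (c : α → 𝕜)
    (hc : ∃ p, (∀ a, 0 < w p a) ∧ Summable fun a => ((w p a)⁻¹ * ‖c a‖) ^ 2) :
    Koethe 𝕜 w →L[𝕜] 𝕜 where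
  toFun f := ∑' a, c a * f a
  map_add' f g := by
    obtain ⟨p, hw, hc⟩ := hc
    rw [← (Koethe.pairing_aux hw hc f).1.tsum_add (Koethe.pairing_aux hw hc g).1]
    exact tsum_congr fun a => mul_add _ _ _
  map_smul' z f := by
    simp only [Koethe.smul_apply, RingHom.id_apply, smul_eq_mul, ← tsum_mul_left]
    exact tsum_congr fun a => mul_left_comm _ _ _
  cont := by
    obtain ⟨p, hw, hc⟩ := hc
    let T : Koethe 𝕜 w →ₗ[𝕜] 𝕜 :=
      { toFun := fun f => ∑' a, c a * f a
        map_add' := fun f g => by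
          rw [← (Koethe.pairing_aux hw hc f).1.tsum_add (Koethe.pairing_aux hw hc g).1]
          exact tsum_congr fun a => mul_add _ _ _
        map_smul' := fun z f => by
          simp only [Koethe.smul_apply, RingHom.id_apply, smul_eq_mul, ← tsum_mul_left]
          exact tsum_congr fun a => mul_left_comm _ _ _ }
    refine WithSeminorms.continuous_normedSpace_rng 𝕜 (Koethe.withSeminorms 𝕜 w) T
      ⟨{p}, ⟨_, Real.sqrt_nonneg (∑' a, ((w p a)⁻¹ * ‖c a‖) ^ 2)⟩, fun f => ?_⟩
    rw [Finset.sup_singleton]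
    exact (Koethe.pairing_aux hw hc f).2

end Koethe

theorem summable_pi_prod {ι : Type} {g : ι → ℝ} (h0 : ∀ j, 0 ≤ g j) (hg : Summable g) (n : ℕ) :
    Summable fun J : Fin n → ι => ∏ i, g (J i) := by
  induction n with
  | zero => exact Summable.of_finite
  | succ n ih =>
    rw [← (Fin.consEquiv fun _ : Fin (n + 1) => ι).summable_iff]
    refine (hg.mul_of_nonneg ih h0 fun J => Finset.prod_nonneg fun i _ => h0 _).congr fun x => ?_
    simp [Fin.prod_univ_succ, Fin.consEquiv]

/-! ### The spaces `E`, `E*` and the tensor powers of `E_ℂ` -/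

namespace Eigenbasis

variable {A : RealL2 →ₗ.[ℝ] RealL2} (S : Eigenbasis A)

theorem one_le (j : S.ι) : 1 ≤ S.lam j := by
  obtain ⟨c, hc, h⟩ := S.one_lt
  exact hc.le.trans (h j)

/-- `E = ⋂_p dom(A ^ p) = {ξ ∈ L²(ℝ, dt) : |A ^ p ξ|₀² = ∑ⱼ (λⱼ ^ p |⟨eⱼ, ξ⟩|)² < ∞ for all p}`. -/
def testSubmodule : Submodule ℝ RealL2 :=
  (koetheSubmodule ℝ fun p j => S.lam j ^ p).comap
    ({ toFun := fun ξ j => inner ℝ (S.e j) ξ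
       map_add' := fun _ _ => funext fun _ => inner_add_right _ _ _
       map_smul' := fun _ _ => funext fun _ => real_inner_smul_right _ _ _ } :
      RealL2 →ₗ[ℝ] S.ι → ℝ)

/-- The real nuclear space `E`, with the topology given by the norms `|ξ|_p = |A ^ p ξ|₀`. -/
def TestSpace : Type := S.testSubmodule

instance : AddCommGroup S.TestSpace := inferInstanceAs (AddCommGroup S.testSubmodule)

instance : Module ℝ S.TestSpace := inferInstanceAs (Module ℝ S.testSubmodule)

/-- The inclusion `E ⊂ L²(ℝ, dt)`. -/
def toL2 : S.TestSpace →ₗ[ℝ] RealL2 := S.testSubmodule.subtype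

theorem summable_coords (ξ : S.TestSpace) (p : ℕ) :
    Summable fun j => (S.lam j ^ p * ‖inner ℝ (S.e j) (S.toL2 ξ)‖) ^ 2 :=
  Subtype.property (p := fun ξ => ξ ∈ S.testSubmodule) ξ p

/-- The coordinates `⟨eⱼ, ξ⟩` of `ξ ∈ E`. -/
def coords : S.TestSpace →ₗ[ℝ] Koethe ℝ fun p j => S.lam j ^ p where
  toFun ξ := Koethe.mk (fun j => inner ℝ (S.e j) (S.toL2 ξ)) (S.summable_coords ξ)
  map_add' ξ η := Koethe.ext fun j => by
    rw [Koethe.add_apply, Koethe.mk_apply, Koethe.mk_apply, Koethe.mk_apply, map_add,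
      inner_add_right]
  map_smul' c ξ := Koethe.ext fun j => by
    rw [RingHom.id_apply, Koethe.smul_apply, Koethe.mk_apply, Koethe.mk_apply, map_smul,
      real_inner_smul_right]

@[simp] theorem coords_apply (ξ : S.TestSpace) (j : S.ι) :
    S.coords ξ j = inner ℝ (S.e j) (S.toL2 ξ) := rfl

/-- The norms `|ξ|_p = |A ^ p ξ|₀` on `E`. -/
def testNorms : SeminormFamily ℝ S.TestSpace ℕ := fun p => (Koethe.norms ℝ _ p).comp S.coords

instance : TopologicalSpace S.TestSpace := S.testNorms.moduleFilterBasis.topology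

theorem testWithSeminorms : WithSeminorms S.testNorms := ⟨rfl⟩

instance : IsTopologicalAddGroup S.TestSpace := S.testWithSeminorms.topologicalAddGroup

instance : ContinuousSMul ℝ S.TestSpace := S.testWithSeminorms.continuousSMul

/-- The space `E*`, the topological dual of `E`. -/
abbrev DualSpace : Type := S.TestSpace →L[ℝ] ℝ

/-- The eigenvector `eⱼ` as an element of `E`. -/
def basisVec (j : S.ι) : S.TestSpace := ⟨S.e j, fun p => by
  classical
  refine summable_of_ne_finset_zero (s := {j}) fun i hi => ?_
  have : inner ℝ (S.e i) (S.e j) = 0 := S.e.orthonormal.2 (by simpa using hi)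
  simp [this]⟩

@[simp] theorem toL2_basisVec (j : S.ι) : S.toL2 (S.basisVec j) = S.e j := rfl

/-- The weight `(λ_{J 1} ⋯ λ_{J n}) ^ p`: the eigenvalue of `(A ^ p)^{⊗ n}` at
`e_{J 1} ⊗ ⋯ ⊗ e_{J n}`. -/
def weight (n p : ℕ) (J : Fin n → S.ι) : ℝ := ∏ i, S.lam (J i) ^ p

theorem weight_pos (n p : ℕ) (J : Fin n → S.ι) : 0 < S.weight n p J :=
  Finset.prod_pos fun _ _ => pow_pos (one_pos.trans_le (S.one_le _)) _

theorem weight_mono (n : ℕ) {p q : ℕ} (h : p ≤ q) (J : Fin n → S.ι) :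
    S.weight n p J ≤ S.weight n q J :=
  Finset.prod_le_prod (fun _ _ => pow_nonneg (zero_le_one.trans (S.one_le _)) _)
    fun _ _ => pow_le_pow_right₀ (S.one_le _) h

/-- The completed tensor power `E_ℂ^{⊗ n}`; `f J` is the coefficient of `f` at
`e_{J 1} ⊗ ⋯ ⊗ e_{J n}`, and the norms are `|f|_p = |(A ^ p)^{⊗ n} f|₀`. -/
abbrev Tensor (n : ℕ) : Type := Koethe ℂ (S.weight n)

/-- The dual space `(E_ℂ^{⊗ n})*`. -/
abbrev Dual (n : ℕ) : Type := S.Tensor n →L[ℂ] ℂ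

variable {S}

theorem Tensor.norms_mono (n : ℕ) : Monotone (Koethe.norms ℂ (S.weight n)) := fun _ _ h =>
  Koethe.norms_mono (fun p J => (S.weight_pos n p J).le) (fun _ _ h J => S.weight_mono n h J) h

theorem summable_permute {n : ℕ} (σ : Equiv.Perm (Fin n)) (f : S.Tensor n) (p : ℕ) :
    Summable (fun J => (S.weight n p J * ‖f (J ∘ σ)‖) ^ 2) ∧
      ∑' J, (S.weight n p J * ‖f (J ∘ σ)‖) ^ 2 = ∑' J, (S.weight n p J * ‖f J‖) ^ 2 := by
  let e := Equiv.arrowCongr σ.symm (Equiv.refl S.ι)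
  have h : (fun J => (S.weight n p J * ‖f J‖) ^ 2) ∘ e =
      fun J => (S.weight n p J * ‖f (J ∘ σ)‖) ^ 2 := by
    funext J
    have h1 : e J = J ∘ σ := rfl
    have h2 : S.weight n p (J ∘ σ) = S.weight n p J :=
      Equiv.prod_comp σ fun i => S.lam (J i) ^ p
    simp only [Function.comp_apply, h1, h2]
  exact ⟨h ▸ e.summable_iff.2 (f.summable p), h ▸ e.tsum_eq fun J => (S.weight n p J * ‖f J‖) ^ 2⟩

/-- The action of a permutation of the tensor factors on `E_ℂ^{⊗ n}`. -/
def permute {n : ℕ} (σ : Equiv.Perm (Fin n)) : S.Tensor n →L[ℂ] S.Tensor n :=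
  let T : S.Tensor n →ₗ[ℂ] S.Tensor n :=
    { toFun := fun f => Koethe.mk (fun J => f (J ∘ σ)) fun p => (summable_permute σ f p).1
      map_add' := fun _ _ => rfl
      map_smul' := fun _ _ => rfl }
  ⟨T, Koethe.continuous_of_bound T fun p => ⟨p, 1, zero_le_one, fun f => by
    rw [one_mul]
    refine (pow_le_pow_iff_left₀ (apply_nonneg _ _) (apply_nonneg _ _) two_ne_zero).1 ?_
    rw [Koethe.norms_sq, Koethe.norms_sq]
    exact (summable_permute σ f p).2.le⟩⟩

/-- `f ∈ (E_ℂ^{⊗ n})_sym`. -/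
def IsSymm {n : ℕ} (f : S.Tensor n) : Prop := ∀ σ : Equiv.Perm (Fin n), permute σ f = f

/-- `κ ∈ (E_ℂ^{⊗ n})*_sym`. -/
def IsSymmDual {n : ℕ} (κ : S.Dual n) : Prop :=
  ∀ (σ : Equiv.Perm (Fin n)) (f : S.Tensor n), κ (permute σ f) = κ f

/-- Concatenation of multi-indices. -/
def join {a b n : ℕ} (h : a + b = n) : (Fin a → S.ι) × (Fin b → S.ι) ≃ (Fin n → S.ι) :=
  (Fin.appendEquiv a b).trans (Equiv.arrowCongr (finCongr h) (Equiv.refl S.ι))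

theorem weight_join {a b n : ℕ} (h : a + b = n) (p : ℕ) (J : Fin a → S.ι) (K : Fin b → S.ι) :
    S.weight n p (join h (J, K)) = S.weight a p J * S.weight b p K := by
  subst h
  have : join rfl (J, K) = Fin.append J K := rfl
  simp [weight, this, Fin.prod_univ_add]

theorem summable_slice {a b n : ℕ} (h : a + b = n) (f : S.Tensor n) (J : Fin a → S.ι) (p : ℕ) :
    Summable fun K => (S.weight b p K * ‖f (join h (J, K))‖) ^ 2 := by
  have h1 := ((join h).summable_iff.2 (f.summable p)).prod_factor J
  refine (h1.mul_left ((S.weight a p J ^ 2)⁻¹)).congr fun K => ?_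
  have := (S.weight_pos a p J).ne'
  simp only [Function.comp_apply, weight_join]
  field_simp

/-- The slice `K ↦ f (J, K)`, an element of `E_ℂ^{⊗ b}`, of an `f ∈ E_ℂ^{⊗ (a + b)}`. -/
def slice {a b n : ℕ} (h : a + b = n) (f : S.Tensor n) (J : Fin a → S.ι) : S.Tensor b :=
  Koethe.mk (fun K => f (join h (J, K))) (summable_slice h f J)

theorem contract_aux {a b n : ℕ} (h : a + b = n) (κ : S.Dual b) (p : ℕ) :
    ∃ (q : ℕ) (C : ℝ), 0 ≤ C ∧ ∀ f : S.Tensor n,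
      Summable (fun J => (S.weight a p J * ‖κ (slice h f J)‖) ^ 2) ∧
      ∑' J, (S.weight a p J * ‖κ (slice h f J)‖) ^ 2 ≤
        (C * Koethe.norms ℂ (S.weight n) q f) ^ 2 := by
  obtain ⟨q, C, hC, hκ⟩ := exists_bound (Koethe.withSeminorms ℂ _) (Tensor.norms_mono b) κ
  refine ⟨max p q, C, hC, fun f => ?_⟩
  have hs := (join h).summable_iff.2 (f.summable (max p q))
  have hle : ∀ J, (S.weight a p J * ‖κ (slice h f J)‖) ^ 2 ≤
      C ^ 2 * ∑' K, ((fun J => (S.weight n (max p q) J * ‖f J‖) ^ 2) ∘ join h) (J, K) := by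
    intro J
    have h1 : ‖κ (slice h f J)‖ ≤ C * Koethe.norms ℂ (S.weight b) (max p q) (slice h f J) :=
      (hκ _).trans (mul_le_mul_of_nonneg_left
        (Tensor.norms_mono b (le_max_right p q) _) hC)
    have h2 : S.weight a p J * ‖κ (slice h f J)‖ ≤ S.weight a (max p q) J *
        (C * Koethe.norms ℂ (S.weight b) (max p q) (slice h f J)) :=
      mul_le_mul (S.weight_mono a (le_max_left p q) J) h1 (norm_nonneg _)
        (S.weight_pos a _ J).le
    refine (pow_le_pow_left₀ (mul_nonneg (S.weight_pos a p J).le (norm_nonneg _)) h2 2).trans_eq ?_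
    rw [mul_pow, mul_pow, Koethe.norms_sq, mul_left_comm, ← tsum_mul_left]
    congr 1
    refine tsum_congr fun K => ?_
    simp only [Function.comp_apply, weight_join, slice, Koethe.mk_apply]
    ring
  have hS := hs.prod.mul_left (C ^ 2)
  have h0 := Summable.of_nonneg_of_le (fun J => sq_nonneg _) hle hS
  refine ⟨h0, (h0.tsum_le_tsum hle hS).trans_eq ?_⟩
  have he := (join h).tsum_eq fun J => (S.weight n (max p q) J * ‖f J‖) ^ 2
  rw [tsum_mul_left, ← hs.tsum_prod, mul_pow, Koethe.norms_sq, ← he]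
  rfl

/-- The right contraction `κ ⊗_b f ∈ E_ℂ^{⊗ a}` of `f ∈ E_ℂ^{⊗ (a + b)}` with
`κ ∈ (E_ℂ^{⊗ b})*`: the functional `κ` acts on the last `b` tensor factors of `f`. -/
def contract {a b n : ℕ} (h : a + b = n) (κ : S.Dual b) : S.Tensor n →L[ℂ] S.Tensor a :=
  let T : S.Tensor n →ₗ[ℂ] S.Tensor a :=
    { toFun := fun f => Koethe.mk (fun J => κ (slice h f J)) fun p => by
        obtain ⟨q, C, -, hf⟩ := contract_aux h κ p
        exact (hf f).1
      map_add' := fun f g => Koethe.ext fun J => map_add κ (slice h f J) (slice h g J)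
      map_smul' := fun c f => Koethe.ext fun J => map_smul κ c (slice h f J) }
  ⟨T, Koethe.continuous_of_bound T fun p => by
    obtain ⟨q, C, hC, hf⟩ := contract_aux h κ p
    refine ⟨q, C, hC, fun f => ?_⟩
    refine (pow_le_pow_iff_left₀ (apply_nonneg _ _)
      (mul_nonneg hC (apply_nonneg _ _)) two_ne_zero).1 ?_
    rw [Koethe.norms_sq]
    exact (hf f).2⟩

/-! ### Tensor products in the dual spaces and Wick tensors -/

/-- The tensor product `κ₁ ⊗ κ₂ ∈ (E_ℂ^{⊗ (a + b)})*`. -/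
def tensor {a b n : ℕ} (h : a + b = n) (κ₁ : S.Dual a) (κ₂ : S.Dual b) : S.Dual n :=
  κ₁.comp (contract h κ₂)

/-- The symmetrization of `κ ∈ (E_ℂ^{⊗ n})*`. -/
def symmetrize {n : ℕ} (κ : S.Dual n) : S.Dual n :=
  ((n.factorial : ℂ)⁻¹) • ∑ σ : Equiv.Perm (Fin n), κ.comp (permute σ)

/-- The symmetric tensor product `κ₁ ⊗̂ κ₂`. -/
def symTensor {a b n : ℕ} (h : a + b = n) (κ₁ : S.Dual a) (κ₂ : S.Dual b) : S.Dual n :=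
  symmetrize (tensor h κ₁ κ₂)

/-- The functional `1 ∈ (E_ℂ^{⊗ 0})* = ℂ`. -/
def one : S.Dual 0 := Koethe.pairing (fun _ => 1) ⟨0, S.weight_pos 0 0, Summable.of_finite⟩

/-- The tensor power `κ^{⊗ k} ∈ (E_ℂ^{⊗ (r k)})*` of `κ ∈ (E_ℂ^{⊗ r})*`. -/
def tensorPow {r : ℕ} (κ : S.Dual r) : (k : ℕ) → S.Dual (r * k)
  | 0 => one
  | k + 1 => tensor (Nat.mul_succ r k).symm (tensorPow κ k) κ

/-- The symmetric tensor power `κ^{⊗̂ k}`. -/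
def symTensorPow {r : ℕ} (κ : S.Dual r) (k : ℕ) : S.Dual (r * k) := symmetrize (tensorPow κ k)

theorem summable_pointPow (x : S.DualSpace) (n : ℕ) :
    ∃ p, (∀ J, 0 < S.weight n p J) ∧
      Summable fun J => ((S.weight n p J)⁻¹ * ‖∏ i, (x (S.basisVec (J i)) : ℂ)‖) ^ 2 := by
  have hm : Monotone S.testNorms := fun p q h ξ =>
    Koethe.norms_mono (fun p j => pow_nonneg (zero_le_one.trans (S.one_le j)) p)
      (fun p q h j => pow_le_pow_right₀ (S.one_le j) h) h (S.coords ξ)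
  obtain ⟨q, C, hC, hx⟩ := exists_bound S.testWithSeminorms hm x
  have hb : ∀ j, S.testNorms q (S.basisVec j) = S.lam j ^ q := by
    intro j
    have hj : 0 ≤ S.lam j ^ q := pow_nonneg (zero_le_one.trans (S.one_le j)) q
    refine (pow_left_inj₀ (apply_nonneg _ _) hj two_ne_zero).1 ?_
    have h1 : S.testNorms q (S.basisVec j) ^ 2 =
        ∑' i, (S.lam i ^ q * ‖(S.coords (S.basisVec j)) i‖) ^ 2 := Koethe.norms_sq q _
    rw [h1, tsum_eq_single j]
    · have : (S.coords (S.basisVec j)) j = 1 := by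
        rw [coords_apply, toL2_basisVec, real_inner_self_eq_norm_sq, S.e.orthonormal.1 j, one_pow]
      simp [this]
    · intro i hi
      have : (S.coords (S.basisVec j)) i = 0 := by
        rw [coords_apply, toL2_basisVec]
        exact S.e.orthonormal.2 hi
      simp [this]
  refine ⟨q + 1, S.weight_pos n _, ?_⟩
  have hg := S.summable_inv_sq.mul_left (C ^ 2)
  have h0 : ∀ j, 0 ≤ C ^ 2 * (S.lam j ^ 2)⁻¹ := fun j => by positivity
  refine Summable.of_nonneg_of_le (fun J => sq_nonneg _) (fun J => ?_) (summable_pi_prod h0 hg n)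
  rw [weight, norm_prod, ← Finset.prod_inv_distrib, ← Finset.prod_mul_distrib, ← Finset.prod_pow]
  refine Finset.prod_le_prod (fun i _ => sq_nonneg _) fun i _ => ?_
  have hl : 0 < S.lam (J i) := one_pos.trans_le (S.one_le _)
  have h1 := hx (S.basisVec (J i))
  rw [hb] at h1
  rw [Complex.norm_real]
  calc ((S.lam (J i) ^ (q + 1))⁻¹ * ‖x (S.basisVec (J i))‖) ^ 2
      ≤ ((S.lam (J i) ^ (q + 1))⁻¹ * (C * S.lam (J i) ^ q)) ^ 2 := by gcongr
    _ = C ^ 2 * (S.lam (J i) ^ 2)⁻¹ := by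
        field_simp
        ring

/-- The tensor power `x^{⊗ n} ∈ (E_ℂ^{⊗ n})*` of `x ∈ E*`. -/
def pointPow (x : S.DualSpace) (n : ℕ) : S.Dual n :=
  Koethe.pairing (fun J => ∏ i, (x (S.basisVec (J i)) : ℂ)) (summable_pointPow x n)

theorem mul_le_of_fin {r n : ℕ} (k : Fin (n / r + 1)) : r * (k : ℕ) ≤ n :=
  (Nat.mul_le_mul_left r (Nat.lt_succ_iff.1 k.2)).trans (Nat.mul_div_le n r)

/-- The renormalized tensor power (generalized Wick tensor)
`:x^{⊗ n}:_κ = ∑_{k ≤ n / r} n! / ((n - r k)! k!) (-½)^k x^{⊗ (n - r k)} ⊗̂ κ^{⊗̂ k}`. -/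
def genWick {r : ℕ} (κ : S.Dual r) (x : S.DualSpace) (n : ℕ) : S.Dual n :=
  ∑ k : Fin (n / r + 1),
    ((n.factorial : ℂ) / ((n - r * (k : ℕ)).factorial * (k : ℕ).factorial) * (-(1 / 2)) ^ (k : ℕ)) •
      symTensor (Nat.sub_add_cancel (mul_le_of_fin k))
        (pointPow x (n - r * (k : ℕ))) (symTensorPow κ k)

open Classical in
theorem summable_trace : ∃ p, (∀ J, 0 < S.weight 2 p J) ∧
    Summable fun J => ((S.weight 2 p J)⁻¹ * ‖(if J 0 = J 1 then 1 else 0 : ℂ)‖) ^ 2 := by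
  refine ⟨1, S.weight_pos 2 1, ?_⟩
  have hinj : Function.Injective fun (j : S.ι) (_ : Fin 2) => j := fun i j h => congrFun h 0
  rw [← hinj.summable_iff]
  · refine Summable.of_nonneg_of_le (fun j => sq_nonneg _) (fun j => ?_) S.summable_inv_sq
    have hl := S.one_le j
    have h1 : S.lam j ^ 2 ≤ (S.lam j ^ 2) ^ 2 := le_self_pow₀ (one_le_pow₀ hl) two_ne_zero
    have h2 : 0 < S.lam j ^ 2 := by positivity
    have h3 : S.weight 2 1 (fun _ => j) = S.lam j ^ 2 := by simp [weight]
    simp only [Function.comp_apply, h3, if_true, norm_one, mul_one, inv_pow]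
    exact inv_anti₀ h2 h1
  · intro J hJ
    have : J 0 ≠ J 1 := fun h => hJ ⟨J 0, by
      funext i
      fin_cases i
      · rfl
      · exact h⟩
    simp [this]

open Classical in
/-- The trace `τ ∈ (E_ℂ^{⊗ 2})*`, `⟨τ, ξ ⊗ η⟩ = ⟨ξ, η⟩`. -/
def trace : S.Dual 2 := Koethe.pairing (fun J => if J 0 = J 1 then 1 else 0) summable_trace

/-- The Wick ordering
`:x^{⊗ n}: = ∑_{k ≤ n / 2} (n choose 2k) (2k - 1)!! (-1)^k x^{⊗ (n - 2k)} ⊗̂ τ^{⊗ k}`. -/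
def wick (x : S.DualSpace) (n : ℕ) : S.Dual n :=
  ∑ k : Fin (n / 2 + 1),
    ((n.choose (2 * (k : ℕ)) : ℂ) * (Nat.doubleFactorial (2 * (k : ℕ) - 1) : ℂ) * (-1) ^ (k : ℕ)) •
      symTensor (Nat.sub_add_cancel (mul_le_of_fin k))
        (pointPow x (n - 2 * (k : ℕ))) (tensorPow trace k)

/-! ### White noise test functions and operators -/

variable (S) in
/-- The weight of the norm `|φ|²_{p,β} = ∑ₙ (n!)^{1+β} |fₙ|²_p`. -/
def fockWeight (β : ℝ) (p : ℕ) (a : Σ n : ℕ, Fin n → S.ι) : ℝ :=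
  (a.1.factorial : ℝ) ^ ((1 + β) / 2) * S.weight a.1 p a.2

variable (S) in
/-- The space `(E)_β` of white noise test functions `φ ∼ (fₙ)`, given by the sequence of its
chaos coefficients `fₙ ∈ (E_ℂ^{⊗ n})_sym`, `φ ⟨n, J⟩ = fₙ J`, with `|φ|_{p,β} < ∞` for all `p`;
the topology is given by the norms `|φ|_{p,β}`. -/
def testFunctions (β : ℝ) : Submodule ℂ (Koethe ℂ (S.fockWeight β)) where
  carrier := {φ | ∀ (n : ℕ) (σ : Equiv.Perm (Fin n)) (J : Fin n → S.ι),
    φ ⟨n, J ∘ σ⟩ = φ ⟨n, J⟩}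
  add_mem' := fun hφ hψ n σ J => congrArg₂ (· + ·) (hφ n σ J) (hψ n σ J)
  zero_mem' := fun _ _ _ => rfl
  smul_mem' := fun c _ hφ n σ J => congrArg (c * ·) (hφ n σ J)

/-- The chaos coefficient `fₙ` of `φ ∼ (fₙ)`. -/
def chaos {β : ℝ} (φ : S.testFunctions β) (n : ℕ) : S.Tensor n :=
  Koethe.mk (fun J => φ.1 ⟨n, J⟩) fun p => by
    have h1 := (φ.1.summable p).comp_injective (sigma_mk_injective (i := n))
    have hn : ((n.factorial : ℝ) ^ ((1 + β) / 2)) ≠ 0 :=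
      (Real.rpow_pos_of_pos (by exact_mod_cast n.factorial_pos) _).ne'
    refine (h1.mul_left (((n.factorial : ℝ) ^ ((1 + β) / 2)) ^ 2)⁻¹).congr fun J => ?_
    simp only [Function.comp_apply, fockWeight]
    field_simp

/-- `φ ∼ (fₙ)` is the function `F` on `E*`: `F x = ∑ₙ ⟨:x^{⊗ n}:, fₙ⟩` for every `x ∈ E*`. -/
def IsFunction {β : ℝ} (φ : S.testFunctions β) (F : S.DualSpace → ℂ) : Prop :=
  ∀ x, HasSum (fun n => wick x n (chaos φ n)) (F x)

/-- `T` is the integral kernel operator `Ξ_{0,r}(κ)` on `(E)_β`: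
`T φ = ∑ₙ (n + r)! / n! ⟨:x^{⊗ n}:, κ ⊗_r f_{n + r}⟩` for `φ ∼ (fₙ)`. -/
def IsIntegralKernelOperator {β : ℝ} {r : ℕ} (κ : S.Dual r)
    (T : S.testFunctions β →L[ℂ] S.testFunctions β) : Prop :=
  ∀ φ n, chaos (T φ) n = ((n + r).factorial / n.factorial : ℂ) • contract rfl κ (chaos φ (n + r))

/-- `U = exp T`: the series `∑ₙ Tⁿ / n!` converges to `U` in `L((E)_β, (E)_β)`, for the topology of
uniform convergence on bounded sets. -/
def IsExp {β : ℝ} (T U : S.testFunctions β →L[ℂ] S.testFunctions β) : Prop :=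
  HasSum (fun n : ℕ => ((n.factorial : ℂ)⁻¹) • T ^ n) U

/-- `ψ` is the exponential vector `Φ_ζ ∼ (ζ^{⊗ n} / n!)` of `ζ = ξ + i η ∈ E_ℂ`. -/
def IsExpVector {β : ℝ} (ψ : S.testFunctions β) (ξ η : S.TestSpace) : Prop :=
  ∀ (n : ℕ) (J : Fin n → S.ι), chaos ψ n J =
    ((n.factorial : ℂ)⁻¹) * ∏ i, ((S.coords ξ (J i) : ℂ) + Complex.I * (S.coords η (J i) : ℂ))

/-- The defining property of the renormalization operator on `(E) = (E)_0`: for every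
`ζ = ξ + i η ∈ E_ℂ` it maps the test function `exp⟨·, ζ⟩` to `Φ_ζ`. -/
def IsRenormalization (Θ : S.testFunctions 0 →L[ℂ] S.testFunctions 0) : Prop :=
  ∀ ξ η : S.TestSpace, ∃ φ : S.testFunctions 0,
    IsFunction φ (fun x => Complex.exp ((x ξ : ℂ) + Complex.I * (x η : ℂ))) ∧
      IsExpVector (Θ φ) ξ η

end Eigenbasis

end WhiteNoise

end

open WhiteNoise WhiteNoise.Eigenbasis

noncomputable section

namespace WhiteNoise

/-! ### Series in spaces topologized by a sequence of seminorms -/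

/-! ### Convergence of vector and operator series under a countable family of seminorms. -/

section SeminormSeries

variable {𝕜 : Type} [RCLike 𝕜] {V : Type} [AddCommGroup V] [Module 𝕜 V] [TopologicalSpace V]
  {N : SeminormFamily 𝕜 V ℕ}

/-! The inverse of `A` is compact and symmetric, so `A` has an orthonormal eigenbasis. In its
coordinates all spaces are weighted sequence spaces, and every identity reduces to vectors on which
the operators act by scalars.

Existence. Contraction with `κ` costs a factor `C` at a fixed level `p`, so the `k`-th power of
`Ξ_{0,r}(κ)` maps degree `m = n + rk` to degree `n` with bound `C^k m!/n!`. Since `(n!)^{1+β}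
(m!/n!)² = (m!)^{1+β} (m!/n!)^{1-β}`, the loss is `(m!/n!)^{1-β}`, which is at most a geometric
factor times `(k!)^{r(1-β)}`. The lower bound on `β` says `r(1-β) ≤ 2`, so in the norm (the square
root) at most one `k!` is lost, and the exponential series pays for it. Geometric factors in `m` are
absorbed by raising `p`, because the eigenvalues stay above some `c > 1`. This is
`exists_level_bound`; with `exists_hasSum_operators` it gives the exponential for uniform
convergence on bounded sets.

Algebra. The exponential vector of `z` is an eigenvector of `Ξ_{0,r}(κ)` with eigenvalue
`κ(z^{⊗r})`. Exponential vectors are total (`functional_eq_zero`, by scaling and polarization), so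
exponentials of such operators commute, and those with opposite factors are inverse to each other.

Functions. Let `evalAt` be the functional `φ ↦ ∑ₙ ⟨x^{⊗n}, fₙ⟩`. On `z^{⊗m}` the exponential series
is finite, and its value under `evalAt` is the generalized Wick tensor at `z^{⊗m}`; polarization
extends this to all `f` (`evalAt_exp_emb`). For `κ = τ` this is ordinary Wick ordering
(`genWick_trace`). Thus, with `U = exp(-½Δ_G)`, the function of `φ` is the power series of `Uφ`.
Since `U` is invertible and a power series determines its coefficients, the function with power
series `ψ` belongs to exactly one test function, `U⁻¹ψ`.

Both parts follow. If `φ = U⁻¹f` is the monomial and `T = exp(-½Ξ)`, then `UTφ = TUφ = Tf`, whose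
power series is the generalized Wick tensor. Also `exp⟨·,ζ⟩` is the function of `U⁻¹Φ_ζ`, so `Θ` is
a renormalization operator iff `ΘU⁻¹` fixes the exponential vectors, that is, iff `Θ = U`. -/

theorem hasSum_iff_seminorms (hN : WithSeminorms N) {γ : Type} {f : γ → V} {g : V} :
    HasSum f g ↔ ∀ p, Filter.Tendsto (fun s : Finset γ => N p (∑ k ∈ s, f k - g))
      Filter.atTop (nhds 0) := by
  rw [HasSum, SummationFilter.unconditional_filter, hN.tendsto_nhds]
  refine forall_congr' fun p => ?_
  rw [Metric.tendsto_nhds]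
  refine forall₂_congr fun ε _ => ?_
  simp [abs_of_nonneg (apply_nonneg (N p) _)]

theorem seminorm_hasSum_le (hN : WithSeminorms N) {γ : Type} {f : γ → V} {g : V} {a : γ → ℝ}
    (hf : HasSum f g) (p : ℕ) (ha : ∀ k, N p (f k) ≤ a k) (hs : Summable a) :
    N p g ≤ ∑' k, a k := by
  have h1 : Filter.Tendsto (fun s : Finset γ => N p (∑ k ∈ s, f k)) Filter.atTop (nhds (N p g)) :=
    ((hN.continuous_seminorm p).tendsto g).comp hf
  refine le_of_tendsto h1 (Filter.Eventually.of_forall fun s => ?_)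
  refine (Finset.le_sum_of_subadditive (N p) (map_zero (N p)).le (map_add_le_add (N p)) s f).trans
    ((Finset.sum_le_sum fun k _ => ha k).trans ?_)
  exact hs.sum_le_tsum s fun k _ => (apply_nonneg _ _).trans (ha k)

/-- The index `q` does not depend on `k`, so one tail of `∑ ε k` controls the tails of all series `∑
T k φ` by `N q φ`. This makes the pointwise sum continuous and the convergence uniform on bounded
sets. -/
theorem exists_hasSum_operators [IsTopologicalAddGroup V] [ContinuousSMul 𝕜 V] [T2Space V]
    (hN : WithSeminorms N)
    (hc : ∀ f : ℕ → V, (∀ p, Summable fun k => N p (f k)) → ∃ g, HasSum f g)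
    (T : ℕ → V →L[𝕜] V) (ε : ℕ → ℝ) (hε : Summable ε)
    (hT : ∀ p, ∃ q, ∀ k φ, N p (T k φ) ≤ ε k * N q φ) : ∃ U, HasSum T U := by
  have hsum : ∀ φ, ∃ g, HasSum (fun k => T k φ) g := fun φ => hc _ fun p => by
    obtain ⟨q, hq⟩ := hT p
    exact Summable.of_nonneg_of_le (fun k => apply_nonneg _ _) (fun k => hq k φ)
      (hε.mul_right (N q φ))
  choose u hu using hsum
  let U₀ : V →ₗ[𝕜] V :=
    { toFun := u
      map_add' := fun φ ψ => (hu (φ + ψ)).unique (by simpa using (hu φ).add (hu ψ))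
      map_smul' := fun c φ => (hu (c • φ)).unique (by simpa using (hu φ).const_smul c) }
  have htail : ∀ p, ∃ q, ∀ (s : Finset ℕ) (φ : V), N p (u φ - ∑ k ∈ s, T k φ) ≤
      (∑' k : {k // k ∉ s}, ε k) * N q φ := by
    intro p
    obtain ⟨q, hq⟩ := hT p
    refine ⟨q, fun s φ => ?_⟩
    have h1 : HasSum (fun k : {k // k ∉ s} => T k φ) (u φ - ∑ k ∈ s, T k φ) := by
      have := (s.hasSum_compl_iff (f := fun k => T k φ)
        (a := u φ - ∑ k ∈ s, T k φ)).2 (by simpa using hu φ)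
      exact this
    rw [← tsum_mul_right]
    exact seminorm_hasSum_le hN h1 p (fun k => hq k φ)
      ((hε.subtype {k | k ∉ s}).mul_right _)
  have hcont : Continuous U₀ := by
    refine WithSeminorms.continuous_of_isBounded hN hN U₀ (Seminorm.IsBounded.of_real fun p => ?_)
    obtain ⟨q, hq⟩ := htail p
    refine ⟨{q}, ∑' k : {k // k ∉ (∅ : Finset ℕ)}, ε k, fun φ => ?_⟩
    rw [Finset.sup_singleton]
    have := hq ∅ φ
    rw [Finset.sum_empty, sub_zero] at this
    exact this
  refine ⟨⟨U₀, hcont⟩, ?_⟩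
  rw [HasSum, SummationFilter.unconditional_filter, ← tendsto_sub_nhds_zero_iff,
    (ContinuousLinearMap.hasBasis_nhds_zero_of_basis hN.hasBasis_zero_ball).tendsto_right_iff]
  rintro ⟨B, ⟨I, r⟩⟩ ⟨hB, hr⟩
  have hev : ∀ p, ∀ᶠ s : Finset ℕ in Filter.atTop, ∀ φ ∈ B, N p (∑ k ∈ s, T k φ - u φ) < r := by
    intro p
    obtain ⟨q, hq⟩ := htail p
    -- On the bounded set `B` the seminorm `N q` stays below `R`, so the tail estimate is uniform in
    -- `φ ∈ B`. The sign of `ε` is not prescribed, hence the absolute values.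
    obtain ⟨R, hR, hRB⟩ := (hN.isVonNBounded_iff_seminorm_bounded.1 hB) q
    have ht := (tendsto_tsum_compl_atTop_zero ε).mul_const R
    rw [zero_mul] at ht
    have ht' := ht.abs
    rw [abs_zero] at ht'
    filter_upwards [(ht'.eventually (gt_mem_nhds hr))] with s hs φ hφ
    rw [map_sub_rev]
    refine (hq s φ).trans_lt (lt_of_le_of_lt ?_ hs)
    rw [abs_mul, abs_of_pos hR]
    exact mul_le_mul (le_abs_self _) (hRB φ hφ).le (apply_nonneg _ _) (abs_nonneg _)
  have hall := (Filter.eventually_all_finset I).2 fun p _ => hev p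
  filter_upwards [hall] with s hs φ hφ
  rw [Seminorm.mem_ball_zero]
  refine Seminorm.finset_sup_apply_lt hr fun p hp => ?_
  have := hs p hp φ hφ
  rw [← sum_apply] at this
  exact this

end SeminormSeries

/-! ### Weighted sequence spaces: coordinates, completeness, density of finite families. -/

namespace Koethe

variable {𝕜 : Type} [RCLike 𝕜] {α : Type} {w : ℕ → α → ℝ}

@[simp] theorem zero_apply (a : α) : (0 : Koethe 𝕜 w) a = 0 := rfl

@[simp] theorem sub_apply (f g : Koethe 𝕜 w) (a : α) : (f - g) a = f a - g a := rfl

@[simp] theorem sum_apply {γ : Type} (s : Finset γ) (f : γ → Koethe 𝕜 w) (a : α) :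
    (∑ k ∈ s, f k) a = ∑ k ∈ s, f k a := by
  classical
  induction s using Finset.induction_on with
  | empty => simp
  | insert k s hk ih => rw [Finset.sum_insert hk, Finset.sum_insert hk, add_apply, ih]

theorem le_norms (hw : ∀ p a, 0 < w p a) (p : ℕ) (f : Koethe 𝕜 w) (a : α) :
    w p a * ‖f a‖ ≤ norms 𝕜 w p f := by
  refine (pow_le_pow_iff_left₀ (mul_nonneg (hw p a).le (norm_nonneg _)) (apply_nonneg _ _)
    two_ne_zero).1 ?_
  rw [norms_sq]
  exact (f.summable p).le_tsum a fun b _ => sq_nonneg _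

/-- The coordinate `f ↦ f a`. -/
def coordL (hw : ∀ p a, 0 < w p a) (a : α) : Koethe 𝕜 w →L[𝕜] 𝕜 where
  toFun f := f a
  map_add' _ _ := rfl
  map_smul' _ _ := rfl
  cont := by
    let T : Koethe 𝕜 w →ₗ[𝕜] 𝕜 :=
      { toFun := fun f => f a, map_add' := fun _ _ => rfl, map_smul' := fun _ _ => rfl }
    refine WithSeminorms.continuous_normedSpace_rng 𝕜 (withSeminorms 𝕜 w) T
      ⟨{0}, ⟨(w 0 a)⁻¹, (inv_pos.2 (hw 0 a)).le⟩, fun f => ?_⟩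
    rw [Finset.sup_singleton]
    have h : ‖f a‖ ≤ (w 0 a)⁻¹ * norms 𝕜 w 0 f := by
      rw [← div_eq_inv_mul, le_div_iff₀' (hw 0 a)]
      exact le_norms hw 0 f a
    exact h

theorem t2Space (hw : ∀ p a, 0 < w p a) : T2Space (Koethe 𝕜 w) := by
  refine ⟨fun f g hfg => ?_⟩
  obtain ⟨a, ha⟩ : ∃ a, f a ≠ g a := by
    by_contra! h
    exact hfg (Koethe.ext h)
  exact separated_by_continuous (coordL hw a).continuous ha

/-- For each `p` the weighted series converges in `ℓ²`. Coordinates are continuous there, so all the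
limits `G p` are weighted copies of the single family `(w 0)⁻¹ G 0`. -/
theorem exists_hasSum (hw : ∀ p a, 0 < w p a) (f : ℕ → Koethe 𝕜 w)
    (hf : ∀ p, Summable fun k => norms 𝕜 w p (f k)) : ∃ g, HasSum f g := by
  have hs : ∀ p, ∃ G, HasSum (fun k => toLp 𝕜 w p (f k)) G := fun p => by
    have : Summable fun k => ‖toLp 𝕜 w p (f k)‖ := hf p
    exact this.of_norm
  choose G hG using hs
  have hcoord : ∀ p a, HasSum (fun k => (w p a : 𝕜) * f k a) (G p a) := fun p a =>
    (hG p).map (lp.evalCLM 𝕜 (fun _ : α => 𝕜) 2 a) (lp.evalCLM 𝕜 (fun _ : α => 𝕜) 2 a).continuous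
  have hw' : ∀ p a, (w p a : 𝕜) ≠ 0 := fun p a => RCLike.ofReal_ne_zero.2 (hw p a).ne'
  have hGp : ∀ p a, (w p a : 𝕜) * ((w 0 a : 𝕜)⁻¹ * G 0 a) = G p a := fun p a => by
    refine HasSum.unique ?_ (hcoord p a)
    refine (((hcoord 0 a).mul_left (w 0 a : 𝕜)⁻¹).mul_left (w p a : 𝕜)).congr_fun fun k => ?_
    rw [inv_mul_cancel_left₀ (hw' 0 a)]
  have hmem : ∀ p, Summable fun a => (w p a * ‖(w 0 a : 𝕜)⁻¹ * G 0 a‖) ^ 2 := fun p => by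
    rw [← memlp_two_iff]
    have := lp.memℓp (G p)
    convert this using 1
    funext a
    exact hGp p a
  refine ⟨mk _ hmem, (hasSum_iff_seminorms (withSeminorms 𝕜 w)).2 fun p => ?_⟩
  have heq : toLp 𝕜 w p (mk _ hmem) = G p := by
    ext a
    exact hGp p a
  have h1 : Filter.Tendsto (fun s : Finset ℕ => ‖∑ k ∈ s, toLp 𝕜 w p (f k) - G p‖)
      Filter.atTop (nhds 0) := tendsto_iff_norm_sub_tendsto_zero.1 (hG p)
  refine h1.congr fun s => ?_
  rw [← heq, ← map_sum, ← map_sub]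
  rfl

/-- The family which is `1` at `a` and `0` elsewhere. -/
def delta [DecidableEq α] (a : α) : Koethe 𝕜 w :=
  mk (Pi.single a 1) fun p => summable_of_ne_finset_zero (s := {a}) fun b hb => by
    rw [Pi.single_eq_of_ne (by simpa using hb)]
    simp

@[simp] theorem delta_apply [DecidableEq α] (a b : α) :
    (delta a : Koethe 𝕜 w) b = (Pi.single a 1 : α → 𝕜) b := rfl

theorem sum_smul_delta_apply [DecidableEq α] (f : Koethe 𝕜 w) (s : Finset α) (b : α) :
    (∑ a ∈ s, f a • (delta a : Koethe 𝕜 w)) b = if b ∈ s then f b else 0 := by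
  rw [sum_apply]
  simp [Pi.single_apply]

/-- The squared error of a partial sum is the tail of `∑ (w p a ‖f a‖)²`. -/
theorem hasSum_delta [DecidableEq α] (f : Koethe 𝕜 w) :
    HasSum (fun a => f a • (delta a : Koethe 𝕜 w)) f := by
  refine (hasSum_iff_seminorms (withSeminorms 𝕜 w)).2 fun p => ?_
  have h1 := tendsto_tsum_compl_atTop_zero fun a => (w p a * ‖f a‖) ^ 2
  have h2 := (Real.continuous_sqrt.tendsto 0).comp h1
  rw [Real.sqrt_zero] at h2
  refine h2.congr fun s => ?_
  rw [Function.comp_apply, ← Real.sqrt_sq (apply_nonneg (norms 𝕜 w p) _), norms_sq]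
  congr 1
  refine (tsum_subtype {a | a ∉ s} fun a => (w p a * ‖f a‖) ^ 2).trans ?_
  refine tsum_congr fun b => ?_
  rw [sub_apply, sum_smul_delta_apply]
  by_cases hb : b ∈ s <;> simp [hb]

theorem clm_ext [DecidableEq α] {V : Type} [AddCommGroup V] [Module 𝕜 V] [TopologicalSpace V]
    [T2Space V] {L M : Koethe 𝕜 w →L[𝕜] V} (h : ∀ a, L (delta a) = M (delta a)) : L = M := by
  ext f
  have h1 := (hasSum_delta f).mapL L
  have h2 := (hasSum_delta f).mapL M
  refine h1.unique (h2.congr_fun fun a => ?_)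
  rw [map_smul, map_smul, h]

end Koethe

namespace Eigenbasis

variable {A : RealL2 →ₗ.[ℝ] RealL2} {S : Eigenbasis A} {β : ℝ}

/-! ### The norms of white noise test functions -/

theorem isSymm_iff {n : ℕ} {f : S.Tensor n} :
    IsSymm f ↔ ∀ (σ : Equiv.Perm (Fin n)) (J : Fin n → S.ι), f (J ∘ σ) = f J :=
  ⟨fun h σ J => DFunLike.congr_fun (h σ) J, fun h σ => Koethe.ext fun J => h σ J⟩

variable (S β) in
theorem fockWeight_pos (p : ℕ) (a : Σ n : ℕ, Fin n → S.ι) : 0 < S.fockWeight β p a :=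
  mul_pos (Real.rpow_pos_of_pos (by exact_mod_cast a.1.factorial_pos) _) (S.weight_pos _ _ _)

theorem fockWeight_mul_sq (p n : ℕ) (J : Fin n → S.ι) (y : ℝ) :
    (S.fockWeight β p ⟨n, J⟩ * y) ^ 2 =
      (n.factorial : ℝ) ^ (1 + β) * (S.weight n p J * y) ^ 2 := by
  have h : (0 : ℝ) ≤ n.factorial := by positivity
  rw [fockWeight, mul_assoc, mul_pow, ← Real.rpow_mul_natCast h]
  norm_num

instance (n : ℕ) : T2Space (Koethe ℂ (S.weight n)) := Koethe.t2Space fun p J => S.weight_pos n p J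

instance : T2Space (Koethe ℂ (S.fockWeight β)) := Koethe.t2Space (S.fockWeight_pos β)

variable (S β) in
/-- The norms `|φ|_{p,β}` on `(E)_β`. -/
def fockNorms : SeminormFamily ℂ (S.testFunctions β) ℕ := fun p =>
  (Koethe.norms ℂ (S.fockWeight β) p).comp (S.testFunctions β).subtype

theorem fockWithSeminorms : WithSeminorms (S.fockNorms β) :=
  Topology.IsInducing.withSeminorms (Koethe.withSeminorms ℂ (S.fockWeight β))
    (f := (S.testFunctions β).subtype) Topology.IsInducing.subtypeVal

@[simp] theorem chaos_add (φ ψ : S.testFunctions β) (n : ℕ) :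
    chaos (φ + ψ) n = chaos φ n + chaos ψ n := rfl

@[simp] theorem chaos_smul (c : ℂ) (φ : S.testFunctions β) (n : ℕ) :
    chaos (c • φ) n = c • chaos φ n := rfl

theorem chaos_isSymm (φ : S.testFunctions β) (n : ℕ) : IsSymm (chaos φ n) :=
  isSymm_iff.2 fun σ J => φ.2 n σ J

theorem testFunctions_ext {φ ψ : S.testFunctions β} (h : ∀ n, chaos φ n = chaos ψ n) : φ = ψ :=
  Subtype.ext (Koethe.ext fun a => DFunLike.congr_fun (h a.1) a.2)

theorem hasSum_fockNorms_sq (p : ℕ) (φ : S.testFunctions β) :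
    HasSum (fun n => (n.factorial : ℝ) ^ (1 + β) * Koethe.norms ℂ (S.weight n) p (chaos φ n) ^ 2)
      (S.fockNorms β p φ ^ 2) := by
  have h1 : S.fockNorms β p φ ^ 2 = ∑' a, (S.fockWeight β p a * ‖φ.1 a‖) ^ 2 :=
    Koethe.norms_sq p φ.1
  rw [h1]
  refine (φ.1.summable p).hasSum.sigma fun n => ?_
  rw [Koethe.norms_sq]
  refine (((chaos φ n).summable p).hasSum.mul_left _).congr_fun fun J => ?_
  exact fockWeight_mul_sq p n J _

/-- The test function with given chaos coefficients. -/
def ofChaos (g : ∀ n, S.Tensor n) (hg : ∀ n, IsSymm (g n))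
    (hs : ∀ p, Summable fun n =>
      (n.factorial : ℝ) ^ (1 + β) * Koethe.norms ℂ (S.weight n) p (g n) ^ 2) :
    S.testFunctions β :=
  ⟨Koethe.mk (fun a => g a.1 a.2) fun p => by
    refine (summable_sigma_of_nonneg fun a => sq_nonneg _).2 ⟨fun n => ?_, ?_⟩
    · refine (((g n).summable p).mul_left ((n.factorial : ℝ) ^ (1 + β))).congr fun J => ?_
      exact (fockWeight_mul_sq p n J _).symm
    · refine (hs p).congr fun n => ?_
      rw [Koethe.norms_sq, ← tsum_mul_left]
      exact tsum_congr fun J => (fockWeight_mul_sq p n J _).symm,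
  fun n σ J => isSymm_iff.1 (hg n) σ J⟩

@[simp] theorem chaos_ofChaos (g : ∀ n, S.Tensor n) (hg : ∀ n, IsSymm (g n))
    (hs : ∀ p, Summable fun n =>
      (n.factorial : ℝ) ^ (1 + β) * Koethe.norms ℂ (S.weight n) p (g n) ^ 2) (n : ℕ) :
    chaos (ofChaos g hg hs) n = g n := rfl

theorem fockNorms_mono : Monotone (S.fockNorms β) := fun _ _ h φ =>
  Koethe.norms_mono (fun p a => (S.fockWeight_pos β p a).le)
    (fun _ _ h a => mul_le_mul_of_nonneg_left (S.weight_mono a.1 h a.2) (by positivity)) h φ.1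

/-- Operators lowering the degree by `d` are estimated degree by degree. The degrees of `φ` below
`d` are simply discarded. -/
theorem fockNorms_le_of_shift {φ ψ : S.testFunctions β} {p q d : ℕ} {M : ℝ} (hM : 0 ≤ M)
    (h : ∀ n, (n.factorial : ℝ) ^ (1 + β) * Koethe.norms ℂ (S.weight n) p (chaos ψ n) ^ 2 ≤
      M ^ 2 * (((n + d).factorial : ℝ) ^ (1 + β) *
        Koethe.norms ℂ (S.weight (n + d)) q (chaos φ (n + d)) ^ 2)) :
    S.fockNorms β p ψ ≤ M * S.fockNorms β q φ := by
  refine (pow_le_pow_iff_left₀ (apply_nonneg _ _) (mul_nonneg hM (apply_nonneg _ _))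
    two_ne_zero).1 ?_
  have hφ := (hasSum_fockNorms_sq q φ)
  have hφ' := hφ.summable.comp_injective (add_left_injective d)
  rw [mul_pow]
  refine (hasSum_le h (hasSum_fockNorms_sq p ψ) (hφ'.hasSum.mul_left (M ^ 2))).trans ?_
  refine mul_le_mul_of_nonneg_left ?_ (sq_nonneg M)
  rw [← hφ.tsum_eq]
  exact tsum_comp_le_tsum_of_inj hφ.summable (fun n => by positivity) (add_left_injective d)

theorem exists_hasSum_testFunctions (f : ℕ → S.testFunctions β)
    (hf : ∀ p, Summable fun k => S.fockNorms β p (f k)) : ∃ g, HasSum f g := by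
  obtain ⟨g, hg⟩ := Koethe.exists_hasSum (S.fockWeight_pos β) (fun k => (f k).1) hf
  have hc : ∀ a, HasSum (fun k => (f k).1 a) (g a) := fun a =>
    hg.mapL (Koethe.coordL (S.fockWeight_pos β) a)
  refine ⟨⟨g, fun n σ J => ?_⟩, ?_⟩
  · refine (hc _).unique ((hc _).congr_fun fun k => ?_)
    exact (f k).2 n σ J
  · refine (hasSum_iff_seminorms fockWithSeminorms).2 fun p => ?_
    refine ((hasSum_iff_seminorms (Koethe.withSeminorms ℂ _)).1 hg p).congr fun s => ?_
    simp [fockNorms]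

variable (S) in
/-- The norms grow geometrically, since the eigenvalues are bounded away from `1`. -/
theorem exists_gap : ∃ c : ℝ, 1 < c ∧ ∀ (n p s : ℕ) (f : S.Tensor n),
    c ^ (s * n) * Koethe.norms ℂ (S.weight n) p f ≤ Koethe.norms ℂ (S.weight n) (p + s) f := by
  obtain ⟨c, hc, hl⟩ := S.one_lt
  have hc0 : 0 < c := one_pos.trans hc
  refine ⟨c, hc, fun n p s f => ?_⟩
  refine (pow_le_pow_iff_left₀ (by positivity) (apply_nonneg _ _) two_ne_zero).1 ?_
  rw [mul_pow, Koethe.norms_sq, Koethe.norms_sq, ← tsum_mul_left]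
  refine ((f.summable p).mul_left _).tsum_le_tsum (fun J => ?_) (f.summable (p + s))
  rw [← mul_pow, ← mul_assoc]
  have hw := S.weight_pos n p J
  gcongr
  rw [weight, weight, pow_mul]
  calc (c ^ s) ^ n * ∏ i, S.lam (J i) ^ p = ∏ i, (c ^ s * S.lam (J i) ^ p) := by
        rw [Finset.prod_mul_distrib, Finset.prod_const, Finset.card_univ, Fintype.card_fin]
    _ ≤ ∏ i, S.lam (J i) ^ (p + s) := by
        refine Finset.prod_le_prod (fun i _ => ?_) fun i _ => ?_
        · have := S.one_le (J i)
          positivity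
        · have h1 := hl (J i)
          have h2 := S.one_le (J i)
          rw [pow_add, mul_comm]
          gcongr

/-! ### The embedding of the tensor powers -/

/-- The symmetrization of a tensor. -/
def symPart (n : ℕ) : S.Tensor n →L[ℂ] S.Tensor n :=
  ((n.factorial : ℂ)⁻¹) • ∑ σ : Equiv.Perm (Fin n), permute σ

theorem symPart_apply {n : ℕ} (f : S.Tensor n) (J : Fin n → S.ι) :
    symPart n f J = (n.factorial : ℂ)⁻¹ * ∑ σ : Equiv.Perm (Fin n), f (J ∘ σ) := by
  have h : symPart n f = (n.factorial : ℂ)⁻¹ • ∑ σ : Equiv.Perm (Fin n), permute σ f := by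
    simp [symPart]
  rw [h, Koethe.smul_apply, Koethe.sum_apply]
  rfl

theorem symPart_isSymm {n : ℕ} (f : S.Tensor n) : IsSymm (symPart n f) := by
  refine isSymm_iff.2 fun σ J => ?_
  rw [symPart_apply, symPart_apply]
  congr 1
  exact Equiv.sum_comp (Equiv.mulLeft σ) fun τ : Equiv.Perm (Fin n) => f (J ∘ τ)

theorem symPart_permute {n : ℕ} (σ : Equiv.Perm (Fin n)) (f : S.Tensor n) :
    symPart n (permute σ f) = symPart n f := by
  refine Koethe.ext fun J => ?_
  rw [symPart_apply, symPart_apply]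
  congr 1
  exact Equiv.sum_comp (Equiv.mulRight σ) fun τ : Equiv.Perm (Fin n) => f (J ∘ τ)

theorem symPart_eq {n : ℕ} {f : S.Tensor n} (hf : IsSymm f) : symPart n f = f := by
  refine Koethe.ext fun J => ?_
  rw [symPart_apply, Finset.sum_congr rfl fun σ _ => isSymm_iff.1 hf σ J, Finset.sum_const,
    Finset.card_univ, Fintype.card_perm, Fintype.card_fin, nsmul_eq_mul, inv_mul_cancel_left₀]
  exact_mod_cast n.factorial_ne_zero

theorem norms_permute {n : ℕ} (σ : Equiv.Perm (Fin n)) (p : ℕ) (f : S.Tensor n) :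
    Koethe.norms ℂ (S.weight n) p (permute σ f) = Koethe.norms ℂ (S.weight n) p f := by
  refine (pow_left_inj₀ (apply_nonneg _ _) (apply_nonneg _ _) two_ne_zero).1 ?_
  rw [Koethe.norms_sq, Koethe.norms_sq]
  exact (summable_permute σ f p).2

theorem norms_symPart_le {n : ℕ} (p : ℕ) (f : S.Tensor n) :
    Koethe.norms ℂ (S.weight n) p (symPart n f) ≤ Koethe.norms ℂ (S.weight n) p f := by
  have h : symPart n f = (n.factorial : ℂ)⁻¹ • ∑ σ : Equiv.Perm (Fin n), permute σ f := by
    simp [symPart]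
  rw [h, map_smul_eq_mul, norm_inv, Complex.norm_natCast,
    inv_mul_le_iff₀ (by exact_mod_cast n.factorial_pos)]
  refine (Finset.le_sum_of_subadditive (Koethe.norms ℂ (S.weight n) p) (map_zero _).le
    (map_add_le_add _) _ _).trans_eq ?_
  simp [norms_permute, Fintype.card_perm]

theorem isSymm_zero {n : ℕ} : IsSymm (0 : S.Tensor n) := fun _ => map_zero _

theorem isSymm_single (n : ℕ) {f : S.Tensor n} (hf : IsSymm f) (m : ℕ) :
    IsSymm ((Pi.single n f : ∀ n, S.Tensor n) m) := by
  rcases eq_or_ne m n with rfl | h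
  · rwa [Pi.single_eq_same]
  · rw [Pi.single_eq_of_ne h]
    exact isSymm_zero

theorem hasSum_single_norms (n : ℕ) (f : S.Tensor n) (p : ℕ) :
    HasSum (fun m => (m.factorial : ℝ) ^ (1 + β) *
      Koethe.norms ℂ (S.weight m) p ((Pi.single n f : ∀ n, S.Tensor n) m) ^ 2)
      ((n.factorial : ℝ) ^ (1 + β) * Koethe.norms ℂ (S.weight n) p f ^ 2) := by
  convert hasSum_single n fun m hm => ?_ using 1
  · rw [Pi.single_eq_same]
  · rw [Pi.single_eq_of_ne hm, map_zero]
    simp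

variable (S β) in
/-- The map `f ↦ φ ∼ (0, …, 0, Sym f, 0, …)`. -/
def emb (n : ℕ) : S.Tensor n →L[ℂ] S.testFunctions β :=
  let T : S.Tensor n →ₗ[ℂ] S.testFunctions β :=
    { toFun := fun f => ofChaos (Pi.single n (symPart n f)) (isSymm_single n (symPart_isSymm f))
        fun p => (hasSum_single_norms n _ p).summable
      map_add' := fun f g => testFunctions_ext fun m => by
        simp only [map_add, Pi.single_add, chaos_ofChaos, chaos_add, Pi.add_apply]
      map_smul' := fun c f => testFunctions_ext fun m => by
        simp only [map_smul, Pi.single_smul, chaos_ofChaos, chaos_smul, Pi.smul_apply,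
          RingHom.id_apply] }
  ⟨T, WithSeminorms.continuous_of_isBounded (Koethe.withSeminorms ℂ (S.weight n))
    fockWithSeminorms T <| Seminorm.IsBounded.of_real fun p => ⟨{p},
      √((n.factorial : ℝ) ^ (1 + β)), fun f => by
      rw [Finset.sup_singleton]
      have h1 : (S.fockNorms β p (T f)) ^ 2 = (n.factorial : ℝ) ^ (1 + β) *
          Koethe.norms ℂ (S.weight n) p (symPart n f) ^ 2 :=
        (hasSum_fockNorms_sq p (T f)).unique (hasSum_single_norms n (symPart n f) p)
      refine (pow_le_pow_iff_left₀ (apply_nonneg _ _)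
        (mul_nonneg (Real.sqrt_nonneg _) (apply_nonneg _ _)) two_ne_zero).1 ?_
      have h2 := norms_symPart_le p f
      have h3 : 0 ≤ Koethe.norms ℂ (S.weight n) p (symPart n f) := apply_nonneg _ _
      rw [mul_pow, Real.sq_sqrt (by positivity)]
      refine h1.trans_le ?_
      gcongr⟩⟩

theorem chaos_emb (n : ℕ) (f : S.Tensor n) (m : ℕ) :
    chaos (S.emb β n f) m = (Pi.single n (symPart n f) : ∀ n, S.Tensor n) m := rfl

theorem chaos_emb_self (n : ℕ) (f : S.Tensor n) : chaos (S.emb β n f) n = symPart n f := by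
  rw [chaos_emb, Pi.single_eq_same]

theorem chaos_emb_of_ne {n m : ℕ} (h : m ≠ n) (f : S.Tensor n) : chaos (S.emb β n f) m = 0 := by
  rw [chaos_emb, Pi.single_eq_of_ne h]

theorem emb_permute {n : ℕ} (σ : Equiv.Perm (Fin n)) (f : S.Tensor n) :
    S.emb β n (permute σ f) = S.emb β n f := testFunctions_ext fun m => by
  rw [chaos_emb, chaos_emb, symPart_permute]

/-- The chaos coefficient as a continuous linear map, coordinate by coordinate. -/
def chaosCoord (n : ℕ) (J : Fin n → S.ι) : S.testFunctions β →L[ℂ] ℂ :=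
  (Koethe.coordL (S.fockWeight_pos β) ⟨n, J⟩).comp (S.testFunctions β).subtypeL

@[simp] theorem chaosCoord_apply (n : ℕ) (J : Fin n → S.ι) (φ : S.testFunctions β) :
    chaosCoord n J φ = chaos φ n J := rfl

/-- By `exists_gap` the degree `n` part at level `p` is at most `c⁻ⁿ` times the norm at level `p +
1`, so the series converges absolutely in each norm. Its coordinates identify the limit. -/
theorem hasSum_emb_chaos (φ : S.testFunctions β) :
    HasSum (fun n => S.emb β n (chaos φ n)) φ := by
  obtain ⟨c, hc, hgap⟩ := S.exists_gap
  have hc0 : 0 < c := one_pos.trans hc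
  have hle : ∀ p n, S.fockNorms β p (S.emb β n (chaos φ n)) ≤
      (c⁻¹) ^ n * S.fockNorms β (p + 1) φ := by
    intro p n
    refine fockNorms_le_of_shift (d := 0) (by positivity) fun m => ?_
    rcases eq_or_ne m n with rfl | h
    · have h1 := hgap m p 1 (chaos φ m)
      rw [one_mul, ← le_div_iff₀' (by positivity), div_eq_inv_mul, ← inv_pow] at h1
      rw [chaos_emb_self, symPart_eq (chaos_isSymm φ m), mul_left_comm, ← mul_pow]
      have h2 : 0 ≤ Koethe.norms ℂ (S.weight m) p (chaos φ m) := apply_nonneg _ _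
      exact mul_le_mul_of_nonneg_left (pow_le_pow_left₀ h2 h1 2) (by positivity)
    · rw [chaos_emb_of_ne h, map_zero, zero_pow two_ne_zero, mul_zero]
      positivity
  obtain ⟨ψ, hψ⟩ := exists_hasSum_testFunctions (fun n => S.emb β n (chaos φ n)) fun p =>
    Summable.of_nonneg_of_le (fun n => apply_nonneg _ _) (hle p)
      ((summable_geometric_of_lt_one (by positivity) (inv_lt_one_of_one_lt₀ hc)).mul_right _)
  have : ψ = φ := testFunctions_ext fun n => Koethe.ext fun J => by
    refine (hψ.mapL (chaosCoord n J)).unique ?_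
    convert hasSum_single n fun m hm => ?_ using 1
    · rw [chaosCoord_apply, chaos_emb_self, symPart_eq (chaos_isSymm φ n)]
    · rw [chaosCoord_apply, chaos_emb_of_ne hm.symm, Koethe.zero_apply]
  rwa [this] at hψ

/-! ### Tensor powers of vectors and exponential vectors -/

theorem hasSum_pi_prod {𝕜 : Type} [RCLike 𝕜] {ι : Type} {g : ι → 𝕜}
    (hg : Summable fun j => ‖g j‖) (n : ℕ) :
    HasSum (fun J : Fin n → ι => ∏ i, g (J i)) ((∑' j, g j) ^ n) := by
  have hn : ∀ n, Summable fun J : Fin n → ι => ‖∏ i, g (J i)‖ := fun n =>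
    (summable_pi_prod (fun j => norm_nonneg (g j)) hg n).congr fun J => (norm_prod _ _).symm
  have key : ∑' J : Fin n → ι, ∏ i, g (J i) = (∑' j, g j) ^ n := by
    induction n with
    | zero => rw [tsum_fintype]; simp
    | succ n ih =>
      rw [← (Fin.consEquiv fun _ : Fin (n + 1) => ι).tsum_eq, pow_succ', ← ih,
        tsum_mul_tsum_of_summable_norm hg (hn n)]
      refine tsum_congr fun x => ?_
      simp [Fin.prod_univ_succ, Fin.consEquiv]
  exact key ▸ (hn n).of_norm.hasSum

variable (S) in
/-- The space `E_ℂ` in coordinates. -/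
abbrev Vec : Type := Koethe ℂ fun p j => S.lam j ^ p

theorem norm_sq_weight_prod (z : S.Vec) (n p : ℕ) (J : Fin n → S.ι) :
    (S.weight n p J * ‖∏ i, z (J i)‖) ^ 2 = ∏ i, (S.lam (J i) ^ p * ‖z (J i)‖) ^ 2 := by
  rw [weight, norm_prod, ← Finset.prod_mul_distrib, Finset.prod_pow]

/-- The tensor power `z^{⊗ n}` of `z ∈ E_ℂ`. -/
def vecPow (z : S.Vec) (n : ℕ) : S.Tensor n :=
  Koethe.mk (fun J => ∏ i, z (J i)) fun p =>
    (summable_pi_prod (fun _ => sq_nonneg _) (z.summable p) n).congr fun J =>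
      (norm_sq_weight_prod z n p J).symm

@[simp] theorem vecPow_apply (z : S.Vec) (n : ℕ) (J : Fin n → S.ι) :
    vecPow z n J = ∏ i, z (J i) := rfl

theorem vecPow_smul (s : ℂ) (z : S.Vec) (n : ℕ) : vecPow (s • z) n = s ^ n • vecPow z n :=
  Koethe.ext fun J => by simp [Finset.prod_mul_distrib]

theorem vecPow_isSymm (z : S.Vec) (n : ℕ) : IsSymm (vecPow z n) :=
  isSymm_iff.2 fun σ J => Equiv.prod_comp σ fun i => z (J i)

theorem norms_vecPow_sq (z : S.Vec) (n p : ℕ) :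
    Koethe.norms ℂ (S.weight n) p (vecPow z n) ^ 2 =
      (∑' j, (S.lam j ^ p * ‖z j‖) ^ 2) ^ n := by
  rw [Koethe.norms_sq]
  refine (tsum_congr fun J => norm_sq_weight_prod z n p J).trans (HasSum.tsum_eq ?_)
  have hg : Summable fun j => ‖(S.lam j ^ p * ‖z j‖) ^ 2‖ := (z.summable p).norm
  exact hasSum_pi_prod hg n

/-- A slice of `z^{⊗(a+b)}` is a multiple of `z^{⊗b}`. On powers, contractions and tensor products
therefore become multiplication of scalars. -/
theorem contract_vecPow {a b n : ℕ} (h : a + b = n) (κ : S.Dual b) (z : S.Vec) :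
    contract h κ (vecPow z n) = κ (vecPow z b) • vecPow z a := by
  subst h
  refine Koethe.ext fun J => ?_
  have hs : slice rfl (vecPow z (a + b)) J = vecPow z a J • vecPow z b := Koethe.ext fun K => by
    have h1 : slice rfl (vecPow z (a + b)) J K = ∏ i, z (Fin.append J K i) := rfl
    rw [h1, Fin.prod_univ_add]
    simp
  have h2 : contract rfl κ (vecPow z (a + b)) J = κ (slice rfl (vecPow z (a + b)) J) := rfl
  rw [h2, hs, map_smul, Koethe.smul_apply, smul_eq_mul, mul_comm]

theorem tensor_vecPow {a b n : ℕ} (h : a + b = n) (κ₁ : S.Dual a) (κ₂ : S.Dual b) (z : S.Vec) :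
    tensor h κ₁ κ₂ (vecPow z n) = κ₁ (vecPow z a) * κ₂ (vecPow z b) := by
  have h1 : tensor h κ₁ κ₂ (vecPow z n) = κ₁ (contract h κ₂ (vecPow z n)) := rfl
  rw [h1, contract_vecPow, map_smul, smul_eq_mul, mul_comm]

theorem symmetrize_apply {n : ℕ} (κ : S.Dual n) (f : S.Tensor n) :
    symmetrize κ f = κ (symPart n f) := by
  simp [symmetrize, symPart]

theorem symmetrize_vecPow {n : ℕ} (κ : S.Dual n) (z : S.Vec) :
    symmetrize κ (vecPow z n) = κ (vecPow z n) := by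
  rw [symmetrize_apply, symPart_eq (vecPow_isSymm z n)]

theorem symmetrize_permute {n : ℕ} (κ : S.Dual n) (σ : Equiv.Perm (Fin n)) (f : S.Tensor n) :
    symmetrize κ (permute σ f) = symmetrize κ f := by
  rw [symmetrize_apply, symmetrize_apply, symPart_permute]

theorem tensorPow_vecPow {r : ℕ} (κ : S.Dual r) (k : ℕ) (z : S.Vec) :
    tensorPow κ k (vecPow z (r * k)) = κ (vecPow z r) ^ k := by
  induction k with
  | zero =>
    have h : tensorPow κ 0 (vecPow z (r * 0)) = ∑' J : Fin 0 → S.ι, 1 * ∏ i, z (J i) := rfl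
    rw [h, tsum_fintype]
    simp
  | succ k ih =>
    have h : tensorPow κ (k + 1) =
      tensor (Nat.mul_succ r k).symm (tensorPow κ k) κ := rfl
    rw [h, tensor_vecPow, ih, pow_succ]

theorem summable_pow_div_factorial_rpow (K : ℝ) (hK : 0 ≤ K) {δ : ℝ} (hδ : 0 < δ) :
    Summable fun n : ℕ => K ^ n / (n.factorial : ℝ) ^ δ := by
  -- The ratio test needs nonzero terms.
  rcases hK.eq_or_lt with rfl | hK
  · refine summable_of_ne_finset_zero (s := {0}) fun n hn => ?_
    rw [zero_pow (by simpa using hn), zero_div]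
  have hpos : ∀ n : ℕ, 0 < K ^ n / (n.factorial : ℝ) ^ δ := fun n =>
    div_pos (pow_pos hK n) (Real.rpow_pos_of_pos (by exact_mod_cast n.factorial_pos) _)
  refine summable_of_ratio_test_tendsto_lt_one (l := 0) one_pos
    (Filter.Eventually.of_forall fun n => (hpos n).ne') ?_
  have h1 : Filter.Tendsto (fun n : ℕ => K / (((n + 1 : ℕ) : ℝ)) ^ δ) Filter.atTop (nhds 0) :=
    ((tendsto_rpow_atTop hδ).comp
      (tendsto_natCast_atTop_atTop.comp (Filter.tendsto_add_atTop_nat 1))).const_div_atTop K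
  refine h1.congr fun n => ?_
  rw [Real.norm_of_nonneg (hpos _).le, Real.norm_of_nonneg (hpos _).le, Nat.factorial_succ,
    Nat.cast_mul, Real.mul_rpow (by positivity) (by positivity), pow_succ]
  have h2 : (0 : ℝ) < (n.factorial : ℝ) ^ δ :=
    Real.rpow_pos_of_pos (by exact_mod_cast n.factorial_pos) _
  have h3 : (0 : ℝ) < ((n + 1 : ℕ) : ℝ) ^ δ := Real.rpow_pos_of_pos (by positivity) _
  field_simp

/-- The exponential vector `Φ_z ∼ (z^{⊗ n} / n!)`. -/
def expVec (hβ : β < 1) (z : S.Vec) : S.testFunctions β :=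
  ofChaos (fun n => (n.factorial : ℂ)⁻¹ • vecPow z n)
    (fun n σ => by rw [map_smul, vecPow_isSymm z n σ]) fun p => by
    -- The squared norm of degree `n` is `|z|_p^{2n} / (n!)^{1-β}`; this is where `β < 1` is needed.
    refine (summable_pow_div_factorial_rpow (∑' j, (S.lam j ^ p * ‖z j‖) ^ 2)
      (tsum_nonneg fun _ => sq_nonneg _) (sub_pos.2 hβ)).congr fun n => ?_
    have hn : (0 : ℝ) < n.factorial := by exact_mod_cast n.factorial_pos
    rw [map_smul_eq_mul, mul_pow, norms_vecPow_sq, norm_inv, Complex.norm_natCast, ← mul_assoc,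
      div_eq_inv_mul, ← Real.rpow_neg hn.le]
    congr 1
    rw [← Real.rpow_natCast, Real.inv_rpow hn.le, ← Real.rpow_neg hn.le, ← Real.rpow_add hn]
    congr 1
    push_cast
    ring

@[simp] theorem chaos_expVec (hβ : β < 1) (z : S.Vec) (n : ℕ) :
    chaos (expVec hβ z) n = (n.factorial : ℂ)⁻¹ • vecPow z n := rfl

/-! ### Totality of the powers and of the exponential vectors -/

variable (S) in
/-- A finitely supported real vector as an element of `E_ℂ`. -/
def finVec (t : S.ι →₀ ℝ) : S.Vec :=
  Koethe.mk (fun j => (t j : ℂ)) fun p =>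
    summable_of_ne_finset_zero (s := t.support) fun j hj => by
      rw [Finsupp.notMem_support_iff.1 hj]
      simp

@[simp] theorem finVec_apply (t : S.ι →₀ ℝ) (j : S.ι) : S.finVec t j = (t j : ℂ) := rfl

theorem finVec_smul (s : ℝ) (t : S.ι →₀ ℝ) : S.finVec (s • t) = (s : ℂ) • S.finVec t :=
  Koethe.ext fun j => by
    rw [finVec_apply, Finsupp.smul_apply, smul_eq_mul, Complex.ofReal_mul]
    rfl

/-- Equal multiplicities mean equinumerous fibres; bijections between the fibres glue to a
permutation. -/
theorem exists_perm_of_sum_single_eq {γ : Type} {n : ℕ} {J K : Fin n → γ}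
    (h : ∑ i, Finsupp.single (J i) 1 = ∑ i, Finsupp.single (K i) (1 : ℕ)) :
    ∃ σ : Equiv.Perm (Fin n), J = K ∘ σ := by
  classical
  have hcount : ∀ (I : Fin n → γ) (c : γ),
      (∑ i, Finsupp.single (I i) (1 : ℕ)) c = Fintype.card {i // I i = c} := by
    intro I c
    rw [Finsupp.finsetSum_apply, Fintype.card_subtype, Finset.card_filter]
    exact Finset.sum_congr rfl fun i _ => Finsupp.single_apply
  have he : ∀ c, Nonempty ({i // J i = c} ≃ {i // K i = c}) := fun c => by
    rw [← Fintype.card_eq, ← hcount, ← hcount, h]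
  exact ⟨Equiv.ofFiberEquiv fun c => (he c).some,
    funext fun i => (Equiv.ofFiberEquiv_map (fun c => (he c).some) i).symm⟩

/-- A complex polynomial vanishing at all real points is zero. By symmetry its coefficient at the
monomial of `K` is `c K` times the number of rearrangements of `K`, which is positive. -/
theorem coeff_eq_zero_of_form_eq_zero {γ : Type} [Fintype γ] {n : ℕ} (c : (Fin n → γ) → ℂ)
    (hc : ∀ (σ : Equiv.Perm (Fin n)) (J : Fin n → γ), c (J ∘ σ) = c J)
    (h : ∀ t : γ → ℝ, ∑ J, c J * ∏ i, (t (J i) : ℂ) = 0) (K : Fin n → γ) : c K = 0 := by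
  classical
  let P : MvPolynomial γ ℂ := ∑ J, MvPolynomial.monomial (∑ i, Finsupp.single (J i) 1) (c J)
  have hP : P = 0 := by
    refine MvPolynomial.funext_set (fun _ => Set.range ((↑) : ℝ → ℂ))
      (fun _ => Set.infinite_range_of_injective Complex.ofReal_injective) fun x hx => ?_
    choose t ht using fun j => hx j (Set.mem_univ j)
    rw [map_zero, map_sum, ← h t]
    refine Finset.sum_congr rfl fun J _ => ?_
    rw [MvPolynomial.eval_monomial]
    congr 1
    rw [← Finsupp.prod_finsetSum_index (fun _ => pow_zero _) fun _ _ _ => pow_add _ _ _]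
    exact Finset.prod_congr rfl fun i _ => by
      rw [Finsupp.prod_single_index (by exact pow_zero _), pow_one, ht]
  have h1 : P.coeff (∑ i, Finsupp.single (K i) 1) = 0 := by rw [hP, MvPolynomial.coeff_zero]
  have h2 : P.coeff (∑ i, Finsupp.single (K i) 1) =
      ∑ J : Fin n → γ, if ∑ i, Finsupp.single (J i) 1 = ∑ i, Finsupp.single (K i) (1 : ℕ)
        then c K else 0 := by
    rw [MvPolynomial.coeff_sum]
    refine Finset.sum_congr rfl fun J _ => ?_
    rw [MvPolynomial.coeff_monomial]
    split_ifs with hJ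
    · obtain ⟨σ, rfl⟩ := exists_perm_of_sum_single_eq hJ
      exact hc σ K
    · rfl
  rw [h2, ← Finset.sum_filter, Finset.sum_const, nsmul_eq_mul] at h1
  refine (mul_eq_zero.1 h1).resolve_left ?_
  exact_mod_cast Finset.card_ne_zero.2 ⟨K, by simp⟩

/-- A symmetric functional is determined by its values at the powers `z^{⊗ n}`. -/
theorem dual_eq_zero {n : ℕ} {L : S.Dual n} (hL : IsSymmDual L)
    (h : ∀ t, L (vecPow (S.finVec t) n) = 0) : L = 0 := by
  classical
  refine Koethe.clm_ext fun K => ?_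
  have hsymm : ∀ (σ : Equiv.Perm (Fin n)) (J : Fin n → S.ι),
      L (Koethe.delta (J ∘ σ)) = L (Koethe.delta J) := by
    intro σ J
    have hd : permute σ (Koethe.delta (J ∘ σ) : S.Tensor n) = Koethe.delta J :=
      Koethe.ext fun I => by
        have h1 : permute σ (Koethe.delta (J ∘ σ) : S.Tensor n) I =
          (Pi.single (J ∘ σ) 1 : (Fin n → S.ι) → ℂ) (I ∘ σ) := rfl
        rw [h1, Koethe.delta_apply, Pi.single_apply, Pi.single_apply]
        simp only [σ.surjective.right_cancellable]
    rw [← hd, hL]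
  -- Only the finitely many indices occurring in `K` matter: on vectors supported in `F` the
  -- functional is a form in finitely many variables.
  let F := Finset.univ.image K
  let K' : Fin n → F := fun i => ⟨K i, Finset.mem_image_of_mem K (Finset.mem_univ i)⟩
  have hinj : Function.Injective fun (J : Fin n → F) (i : Fin n) => (J i : S.ι) :=
    fun J J' hJ => funext fun i => Subtype.ext (congrFun hJ i)
  refine coeff_eq_zero_of_form_eq_zero
    (fun J : Fin n → F => L (Koethe.delta fun i => (J i : S.ι)))
    (fun σ J => hsymm σ fun i => (J i : S.ι)) (fun t => ?_) K'
  let t' : S.ι →₀ ℝ := Finsupp.onFinset F (fun j => if hj : j ∈ F then t ⟨j, hj⟩ else 0)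
    fun j hj => by
      by_contra hF
      exact hj (dif_neg hF)
  have ht' : ∀ j : F, t' j = t j := fun j => dif_pos j.2
  have hsum := (Koethe.hasSum_delta (vecPow (S.finVec t') n)).mapL L
  rw [h t', ← hinj.hasSum_iff] at hsum
  · refine (hasSum_fintype _).unique (hsum.congr_fun fun J => ?_)
    simp only [Function.comp_apply, map_smul, vecPow_apply, finVec_apply, ht', smul_eq_mul]
    exact mul_comm _ _
  · intro J hJ
    obtain ⟨i, hi⟩ : ∃ i, J i ∉ F := by
      by_contra! hF
      exact hJ ⟨fun i => ⟨J i, hF i⟩, rfl⟩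
    have h0 : t' (J i) = 0 := dif_neg hi
    have : vecPow (S.finVec t') n J = 0 := by
      rw [vecPow_apply]
      exact Finset.prod_eq_zero (Finset.mem_univ i) (by simp [h0])
    rw [this, zero_smul, map_zero]

/-- Uniqueness of the power series expansion of the zero function at `0`. -/
theorem eq_zero_of_hasSum_pow {a : ℕ → ℂ} (h : ∀ s : ℝ, HasSum (fun n => (s : ℂ) ^ n * a n) 0)
    (n : ℕ) : a n = 0 := by
  let P : FormalMultilinearSeries ℝ ℝ ℂ := fun n => ContinuousMultilinearMap.mkPiRing ℝ (Fin n) (a n)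
  have hcoeff : ∀ n, P.coeff n = a n := fun n => by
    simp [P, FormalMultilinearSeries.coeff]
  have h1 : HasFPowerSeriesAt (0 : ℝ → ℂ) P 0 := by
    rw [hasFPowerSeriesAt_iff]
    refine Filter.Eventually.of_forall fun s => ?_
    refine (h s).congr_fun fun n => ?_
    rw [hcoeff, Complex.real_smul, Complex.ofReal_pow]
  rw [← hcoeff, h1.eq_zero]
  simp [FormalMultilinearSeries.coeff]

/-- The exponential vectors are total. -/
theorem functional_eq_zero (hβ : β < 1) {l : S.testFunctions β →L[ℂ] ℂ}
    (h : ∀ t, l (expVec hβ (S.finVec t)) = 0) : l = 0 := by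
  have h0 : ∀ n, l.comp (S.emb β n) = 0 := fun n => by
    refine dual_eq_zero (fun σ f => ?_) fun t => ?_
    · rw [ContinuousLinearMap.comp_apply, emb_permute, ContinuousLinearMap.comp_apply]
    -- Replacing `t` by `s • t` turns the expansion of `l` at the exponential vector into a power
    -- series in `s`, so every degree vanishes separately.
    · have h1 := eq_zero_of_hasSum_pow (a := fun n => (n.factorial : ℂ)⁻¹ *
        l (S.emb β n (vecPow (S.finVec t) n))) (fun s => ?_) n
      · refine (mul_eq_zero.1 h1).resolve_left (inv_ne_zero ?_)
        exact_mod_cast n.factorial_ne_zero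
      · have h2 := (hasSum_emb_chaos (expVec hβ (S.finVec (s • t)))).mapL l
        rw [h] at h2
        refine h2.congr_fun fun n => ?_
        rw [chaos_expVec, finVec_smul, vecPow_smul]
        simp only [map_smul, smul_eq_mul]
        ring
  ext φ
  refine ((hasSum_emb_chaos φ).mapL l).unique ?_
  refine hasSum_zero.congr_fun fun n => ?_
  exact DFunLike.congr_fun (h0 n) (chaos φ n)

/-- Each coordinate of `T - U` is a functional vanishing on a total set. -/
theorem operator_ext (hβ : β < 1) {T U : S.testFunctions β →L[ℂ] S.testFunctions β}
    (h : ∀ t, T (expVec hβ (S.finVec t)) = U (expVec hβ (S.finVec t))) : T = U := by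
  ext1 φ
  refine testFunctions_ext fun n => Koethe.ext fun J => ?_
  have h1 : (chaosCoord n J).comp (T - U) = 0 := functional_eq_zero hβ fun t => by
    rw [ContinuousLinearMap.comp_apply, sub_apply, h, sub_self, map_zero]
  have h2 := DFunLike.congr_fun h1 φ
  rw [ContinuousLinearMap.comp_apply, sub_apply, map_sub] at h2
  exact sub_eq_zero.1 h2

/-! ### Evaluation of the power series `∑ₙ ⟨x^{⊗ n}, fₙ⟩` -/

theorem summable_dual_coords (x : S.DualSpace) :
    ∃ p, Summable fun j => ((S.lam j ^ p)⁻¹ * ‖(x (S.basisVec j) : ℂ)‖) ^ 2 := by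
  obtain ⟨p, -, hp⟩ := summable_pointPow x 1
  refine ⟨p, ((Equiv.funUnique (Fin 1) S.ι).symm.summable_iff.2 hp).congr fun j => ?_⟩
  simp [weight]

/-- The dual norm of the family `(x^{⊗n})ₙ` has square `∑ₙ Kⁿ / (n!)^{1+β}`, where `K` is the
squared dual norm of `x` at level `p`. -/
theorem summable_fock_dual (hβ : 0 ≤ β) (x : S.DualSpace) :
    ∃ p, (∀ a, 0 < S.fockWeight β p a) ∧ Summable fun a : Σ n : ℕ, Fin n → S.ι =>
      ((S.fockWeight β p a)⁻¹ * ‖∏ i, (x (S.basisVec (a.2 i)) : ℂ)‖) ^ 2 := by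
  obtain ⟨p, hp⟩ := summable_dual_coords x
  refine ⟨p, S.fockWeight_pos β p, ?_⟩
  have hterm : ∀ (n : ℕ) (J : Fin n → S.ι),
      ((S.fockWeight β p ⟨n, J⟩)⁻¹ * ‖∏ i, (x (S.basisVec (J i)) : ℂ)‖) ^ 2 =
        ((n.factorial : ℝ) ^ (1 + β))⁻¹ *
          ∏ i, ((S.lam (J i) ^ p)⁻¹ * ‖(x (S.basisVec (J i)) : ℂ)‖) ^ 2 := by
    intro n J
    have h : (0 : ℝ) ≤ n.factorial := by positivity
    have h2 : ((n.factorial : ℝ) ^ ((1 + β) / 2)) ^ 2 = (n.factorial : ℝ) ^ (1 + β) := by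
      rw [← Real.rpow_mul_natCast h]
      norm_num
    rw [fockWeight, mul_inv, mul_assoc, mul_pow, inv_pow, h2, weight, norm_prod,
      ← Finset.prod_inv_distrib, ← Finset.prod_mul_distrib, Finset.prod_pow]
  refine (summable_sigma_of_nonneg fun a => sq_nonneg _).2 ⟨fun n => ?_, ?_⟩
  · exact ((summable_pi_prod (fun _ => sq_nonneg _) hp n).mul_left
      ((n.factorial : ℝ) ^ (1 + β))⁻¹).congr fun J => (hterm n J).symm
  · refine (summable_pow_div_factorial_rpow
      (∑' j, ((S.lam j ^ p)⁻¹ * ‖(x (S.basisVec j) : ℂ)‖) ^ 2)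
      (tsum_nonneg fun _ => sq_nonneg _) (by linarith : 0 < 1 + β)).congr fun n => ?_
    have hg : Summable fun j => ‖((S.lam j ^ p)⁻¹ * ‖(x (S.basisVec j) : ℂ)‖) ^ 2‖ := hp.norm
    rw [tsum_congr fun J => hterm n J, tsum_mul_left, (hasSum_pi_prod hg n).tsum_eq,
      div_eq_inv_mul]

/-- The functional `φ ↦ ∑ₙ ⟨x^{⊗ n}, fₙ⟩` on `(E)_β`. -/
def evalAt (hβ : 0 ≤ β) (x : S.DualSpace) : S.testFunctions β →L[ℂ] ℂ :=
  (Koethe.pairing (fun a : Σ n : ℕ, Fin n → S.ι => ∏ i, (x (S.basisVec (a.2 i)) : ℂ))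
    (summable_fock_dual hβ x)).comp (S.testFunctions β).subtypeL

theorem pointPow_apply (x : S.DualSpace) (n : ℕ) (f : S.Tensor n) :
    pointPow x n f = ∑' J : Fin n → S.ι, (∏ i, (x (S.basisVec (J i)) : ℂ)) * f J := rfl

theorem evalAt_emb (hβ : 0 ≤ β) (x : S.DualSpace) {n : ℕ} {f : S.Tensor n} (hf : IsSymm f) :
    evalAt hβ x (S.emb β n f) = pointPow x n f := by
  have h1 : evalAt hβ x (S.emb β n f) = ∑' a : Σ n : ℕ, Fin n → S.ι,
      (∏ i, (x (S.basisVec (a.2 i)) : ℂ)) * chaos (S.emb β n f) a.1 a.2 := rfl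
  rw [h1, pointPow_apply, ← (sigma_mk_injective (i := n)).tsum_eq]
  · refine tsum_congr fun J => ?_
    rw [chaos_emb_self, symPart_eq hf]
  · rintro ⟨m, J⟩ hm
    rcases eq_or_ne m n with rfl | h
    · exact ⟨J, rfl⟩
    · refine absurd ?_ hm
      simp only
      rw [chaos_emb_of_ne h, Koethe.zero_apply, mul_zero]

theorem hasSum_evalAt (hβ : 0 ≤ β) (x : S.DualSpace) (φ : S.testFunctions β) :
    HasSum (fun n => pointPow x n (chaos φ n)) (evalAt hβ x φ) :=
  ((hasSum_emb_chaos φ).mapL (evalAt hβ x)).congr_fun fun n =>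
    (evalAt_emb hβ x (chaos_isSymm φ n)).symm

/-- The pairing `⟨x, z⟩` of `x ∈ E*` with `z ∈ E_ℂ`. -/
def dualPair (x : S.DualSpace) (z : S.Vec) : ℂ := ∑' j, (x (S.basisVec j) : ℂ) * z j

theorem summable_dualPair (x : S.DualSpace) (z : S.Vec) :
    Summable fun j => (x (S.basisVec j) : ℂ) * z j := by
  obtain ⟨p, hp⟩ := summable_dual_coords x
  exact (Koethe.pairing_aux (w := fun p j => S.lam j ^ p) (c := fun j => (x (S.basisVec j) : ℂ))
    (p := p) (fun j => pow_pos (one_pos.trans_le (S.one_le j)) p) hp z).1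

theorem pointPow_vecPow (x : S.DualSpace) (n : ℕ) (z : S.Vec) :
    pointPow x n (vecPow z n) = dualPair x z ^ n := by
  have h0 : Summable fun j => ‖(x (S.basisVec j) : ℂ) * z j‖ := (summable_dualPair x z).norm
  have h1 := (hasSum_pi_prod (𝕜 := ℂ) (g := fun j => (x (S.basisVec j) : ℂ) * z j) h0 n).tsum_eq
  refine Eq.trans ?_ h1
  rw [pointPow_apply]
  refine tsum_congr fun J => ?_
  rw [vecPow_apply, ← Finset.prod_mul_distrib]

theorem evalAt_expVec (hβ : 0 ≤ β) (hβ' : β < 1) (x : S.DualSpace) (z : S.Vec) :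
    evalAt hβ x (expVec hβ' z) = Complex.exp (dualPair x z) := by
  refine (hasSum_evalAt hβ x (expVec hβ' z)).unique ?_
  rw [Complex.exp_eq_exp_ℂ]
  refine (NormedSpace.expSeries_div_hasSum_exp (dualPair x z)).congr_fun fun n => ?_
  rw [chaos_expVec, map_smul, pointPow_vecPow, smul_eq_mul, div_eq_inv_mul]

theorem coords_basisVec [DecidableEq S.ι] (j : S.ι) : S.coords (S.basisVec j) = Koethe.delta j :=
  Koethe.ext fun i => by
    rw [coords_apply, toL2_basisVec, Koethe.delta_apply, Pi.single_apply]
    exact orthonormal_iff_ite.1 S.e.orthonormal i j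

/-- Links an abstract `x ∈ E*` to its coordinates: by continuity `x ξ = ∑ⱼ x(eⱼ) ⟨eⱼ, ξ⟩`. -/
theorem hasSum_basisVec (ξ : S.TestSpace) :
    HasSum (fun j => S.coords ξ j • S.basisVec j) ξ := by
  classical
  refine (hasSum_iff_seminorms S.testWithSeminorms).2 fun p => ?_
  refine ((hasSum_iff_seminorms (Koethe.withSeminorms ℝ _)).1
    (Koethe.hasSum_delta (S.coords ξ)) p).congr fun s => ?_
  have h : S.coords (∑ j ∈ s, S.coords ξ j • S.basisVec j - ξ) =
      ∑ j ∈ s, S.coords ξ j • Koethe.delta j - S.coords ξ := by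
    rw [map_sub, map_sum]
    simp only [map_smul, coords_basisVec]
  rw [testNorms, Seminorm.comp_apply, h]

/-- The vector `ξ + i η ∈ E_ℂ`. -/
def complexVec (ξ η : S.TestSpace) : S.Vec :=
  Koethe.mk (fun j => (S.coords ξ j : ℂ) + Complex.I * (S.coords η j : ℂ)) <| by
    have h : ∀ ξ : S.TestSpace, (fun j => (S.coords ξ j : ℂ)) ∈
        koetheSubmodule ℂ fun p j => S.lam j ^ p := fun ξ p =>
      ((S.coords ξ).summable p).congr fun j => by rw [Complex.norm_real]
    exact Submodule.add_mem _ (h ξ) (Submodule.smul_mem _ Complex.I (h η))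

theorem dualPair_complexVec (x : S.DualSpace) (ξ η : S.TestSpace) :
    dualPair x (complexVec ξ η) = (x ξ : ℂ) + Complex.I * (x η : ℂ) := by
  have h : ∀ ξ, HasSum (fun j => (x (S.basisVec j) : ℂ) * (S.coords ξ j : ℂ)) (x ξ : ℂ) := by
    intro ξ
    have h1 := (Complex.hasSum_ofReal.2 ((hasSum_basisVec ξ).mapL x))
    refine h1.congr_fun fun j => ?_
    rw [map_smul, smul_eq_mul, Complex.ofReal_mul, mul_comm]
  refine (((h ξ).add ((h η).mul_left Complex.I)).congr_fun fun j => ?_).tsum_eq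
  have h2 : complexVec ξ η j = (S.coords ξ j : ℂ) + Complex.I * (S.coords η j : ℂ) := rfl
  rw [h2]
  ring

theorem isExpVector_iff (hβ : β < 1) {ψ : S.testFunctions β} {ξ η : S.TestSpace} :
    IsExpVector ψ ξ η ↔ ψ = expVec hβ (complexVec ξ η) :=
  ⟨fun h => testFunctions_ext fun n => Koethe.ext fun J => h n J, fun h n J => by rw [h]; rfl⟩

theorem exists_complexVec_eq_finVec (t : S.ι →₀ ℝ) : ∃ ξ, complexVec ξ 0 = S.finVec t := by
  classical
  refine ⟨t.sum fun j a => a • S.basisVec j, Koethe.ext fun i => ?_⟩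
  have h : complexVec (t.sum fun j a => a • S.basisVec j) 0 i =
    (S.coords (t.sum fun j a => a • S.basisVec j) i : ℂ) +
      Complex.I * (S.coords (0 : S.TestSpace) i : ℂ) := rfl
  rw [h, map_zero, Koethe.zero_apply, Complex.ofReal_zero, mul_zero, add_zero, finVec_apply,
    Finsupp.sum, map_sum, Koethe.sum_apply]
  congr 1
  simp only [map_smul, coords_basisVec, Koethe.smul_apply, Koethe.delta_apply, Pi.single_apply]
  simp [eq_comm]

theorem exists_dual_of_finsupp (t : S.ι →₀ ℝ) : ∃ x : S.DualSpace, ∀ j, x (S.basisVec j) = t j := by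
  classical
  have hw : ∀ (p : ℕ) (j : S.ι), 0 < S.lam j ^ p := fun p j =>
    pow_pos (one_pos.trans_le (S.one_le j)) p
  have hc : Continuous S.coords :=
    WithSeminorms.continuous_of_isBounded S.testWithSeminorms (Koethe.withSeminorms ℝ _) S.coords
      (Seminorm.IsBounded.of_real fun p => ⟨{p}, 1, fun ξ => by
        rw [Finset.sup_singleton, one_mul]
        exact le_rfl⟩)
  let coordsL : S.TestSpace →L[ℝ] Koethe ℝ fun p j => S.lam j ^ p := ⟨S.coords, hc⟩
  refine ⟨t.sum fun j a => a • (Koethe.coordL hw j).comp coordsL, fun i => ?_⟩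
  have h : ∀ j, ((Koethe.coordL hw j).comp coordsL) (S.basisVec i) =
      S.coords (S.basisVec i) j := fun j => rfl
  rw [Finsupp.sum, sum_apply]
  simp only [smul_apply, h, coords_basisVec, Koethe.delta_apply, Pi.single_apply]
  simp [eq_comm]

/-- A power series on `E*` that vanishes identically has zero coefficients. -/
theorem eq_zero_of_evalAt (hβ : 0 ≤ β) {φ : S.testFunctions β} (h : ∀ x, evalAt hβ x φ = 0) :
    φ = 0 := by
  classical
  refine testFunctions_ext fun n => Koethe.ext fun K => ?_
  have hc : ∃ p, (∀ J, 0 < S.weight n p J) ∧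
      Summable fun J => ((S.weight n p J)⁻¹ * ‖chaos φ n J‖) ^ 2 := by
    refine ⟨0, S.weight_pos n 0, ((chaos φ n).summable 0).congr fun J => ?_⟩
    simp [weight]
  -- The roles are exchanged: the coefficients of `φ` define a symmetric functional, whose value at
  -- `t^{⊗n}` is `⟨x^{⊗n}, fₙ⟩` for the `x` with coordinates `t`.
  let L : S.Dual n := Koethe.pairing (fun J => chaos φ n J) hc
  have hL : ∀ f, L f = ∑' J, chaos φ n J * f J := fun f => rfl
  have hL0 : L = 0 := by
    refine dual_eq_zero (fun σ f => ?_) fun t => ?_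
    · rw [hL, hL, ← (Equiv.arrowCongr σ.symm (Equiv.refl S.ι)).tsum_eq fun J => chaos φ n J * f J]
      refine tsum_congr fun J => ?_
      exact congrArg (· * f (J ∘ σ)) (isSymm_iff.1 (chaos_isSymm φ n) σ J).symm
    · obtain ⟨x, hx⟩ := exists_dual_of_finsupp t
      have h1 : L (vecPow (S.finVec t) n) = pointPow x n (chaos φ n) := by
        rw [hL, pointPow_apply]
        refine tsum_congr fun J => ?_
        simp only [vecPow_apply, finVec_apply, hx]
        exact mul_comm _ _
      rw [h1]
      -- Scaling `x` by `s` separates the degrees.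
      refine eq_zero_of_hasSum_pow (a := fun n => pointPow x n (chaos φ n)) (fun s => ?_) n
      have h2 := hasSum_evalAt hβ (s • x) φ
      rw [h] at h2
      refine h2.congr_fun fun m => ?_
      rw [pointPow_apply, pointPow_apply, ← tsum_mul_left]
      refine tsum_congr fun J => ?_
      simp only [smul_apply, smul_eq_mul, Complex.ofReal_mul, Finset.prod_mul_distrib,
        Finset.prod_const, Finset.card_univ, Fintype.card_fin]
      ring
  have h3 : L (Koethe.delta K) = chaos φ n K := by
    rw [hL, tsum_eq_single K]
    · simp
    · intro J hJ
      rw [Koethe.delta_apply, Pi.single_eq_of_ne hJ, mul_zero]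
  rw [← h3, hL0]
  rfl

/-! ### Integral kernel operators and their exponentials -/

/-- A permutation of the first `a` factors extends by the identity on the last `b`. -/
theorem contract_isSymm {a b n : ℕ} (h : a + b = n) (κ : S.Dual b) {f : S.Tensor n}
    (hf : IsSymm f) : IsSymm (contract h κ f) := by
  subst h
  refine isSymm_iff.2 fun σ J => ?_
  have hs : slice rfl f (J ∘ σ) = slice rfl f J := Koethe.ext fun K => by
    have h1 : Fin.append (J ∘ σ) K =
        Fin.append J K ∘ finSumFinEquiv.permCongr (Equiv.sumCongr σ (Equiv.refl (Fin b))) := by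
      funext i
      refine Fin.addCases (fun i => ?_) (fun i => ?_) i <;> simp [Equiv.permCongr_apply]
    have h2 := isSymm_iff.1 hf
      (finSumFinEquiv.permCongr (Equiv.sumCongr σ (Equiv.refl (Fin b)))) (Fin.append J K)
    rw [← h1] at h2
    exact h2
  exact congrArg κ hs

/-- In contrast to `contract_aux`, `q` and `C` depend on `κ` alone and no level is lost once `p ≥
q`, so the bound can be iterated at a fixed `p`. -/
theorem exists_norms_contract_le {b : ℕ} (κ : S.Dual b) :
    ∃ (q : ℕ) (C : ℝ), 0 ≤ C ∧ ∀ (a n p : ℕ) (h : a + b = n) (f : S.Tensor n), q ≤ p →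
      Koethe.norms ℂ (S.weight a) p (contract h κ f) ≤ C * Koethe.norms ℂ (S.weight n) p f := by
  obtain ⟨q, C, hC, hκ⟩ := exists_bound (Koethe.withSeminorms ℂ _) (Tensor.norms_mono b) κ
  refine ⟨q, C, hC, fun a n p h f hp => ?_⟩
  refine (pow_le_pow_iff_left₀ (apply_nonneg _ _) (mul_nonneg hC (apply_nonneg _ _))
    two_ne_zero).1 ?_
  have hs := (join h).summable_iff.2 (f.summable p)
  have hle : ∀ J, (S.weight a p J * ‖contract h κ f J‖) ^ 2 ≤
      C ^ 2 * ∑' K, ((fun J => (S.weight n p J * ‖f J‖) ^ 2) ∘ join h) (J, K) := by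
    intro J
    have h1 : ‖κ (slice h f J)‖ ≤ C * Koethe.norms ℂ (S.weight b) p (slice h f J) :=
      (hκ _).trans (mul_le_mul_of_nonneg_left (Tensor.norms_mono b hp _) hC)
    have h2 := mul_le_mul_of_nonneg_left h1 (S.weight_pos a p J).le
    refine (pow_le_pow_left₀ (mul_nonneg (S.weight_pos a p J).le (norm_nonneg _)) h2 2).trans_eq ?_
    rw [mul_pow, mul_pow, Koethe.norms_sq, mul_left_comm, ← tsum_mul_left]
    congr 1
    refine tsum_congr fun K => ?_
    simp only [Function.comp_apply, weight_join, slice, Koethe.mk_apply]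
    ring
  rw [mul_pow, Koethe.norms_sq, Koethe.norms_sq, ← (join h).tsum_eq]
  refine (((contract h κ f).summable p).tsum_le_tsum hle (hs.prod.mul_left (C ^ 2))).trans_eq ?_
  rw [tsum_mul_left, ← hs.tsum_prod]
  rfl

/-! ### Factorial estimates. -/

theorem factorial_mul_le (r k : ℕ) :
    (r * k).factorial ≤ 2 ^ (r ^ 2 * k) * k.factorial ^ r := by
  induction r with
  | zero => simp
  | succ r ih =>
    have h1 := Nat.add_choose_mul_factorial_mul_factorial (r * k) k
    have h2 : (r * k + k).choose k ≤ 2 ^ (r * k + k) := Nat.choose_le_two_pow _ _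
    -- The exponent `r² k` is generous enough for the induction: `r² + r + 1 ≤ (r + 1)²`.
    have h3 : 2 ^ (r * k + k) * 2 ^ (r ^ 2 * k) ≤ 2 ^ ((r + 1) ^ 2 * k) := by
      rw [← pow_add]
      exact Nat.pow_le_pow_right two_pos (by nlinarith)
    rw [Nat.add_mul, one_mul, ← h1]
    calc (r * k + k).choose k * (r * k).factorial * k.factorial
        ≤ 2 ^ (r * k + k) * (2 ^ (r ^ 2 * k) * k.factorial ^ r) * k.factorial := by gcongr
      _ = (2 ^ (r * k + k) * 2 ^ (r ^ 2 * k)) * k.factorial ^ (r + 1) := by ring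
      _ ≤ 2 ^ ((r + 1) ^ 2 * k) * k.factorial ^ (r + 1) := by gcongr

/-- The quotient is a binomial coefficient times `(rk)!`, hence at most a power of `2` times
`(k!)^r`. Raising it to the power `1 - β` leaves `(k!)^{r(1-β)}`, and `r(1-β) ≤ 2` by the lower
bound on `β`. -/
theorem factorial_ratio_rpow_le {r : ℕ} (hr : 1 ≤ r) (hβ : max 0 ((r : ℝ) - 2) / r ≤ β)
    (hβ' : β < 1) (n k : ℕ) :
    (((n + r * k).factorial : ℝ) / n.factorial) ^ (1 - β) ≤
      2 ^ (n + r * k) * (2 ^ (r ^ 2)) ^ k * (k.factorial : ℝ) ^ 2 := by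
  have hr0 : (0 : ℝ) < r := by exact_mod_cast hr
  have hβ0 : 0 ≤ β := le_trans (by positivity) hβ
  have hrβ : (r : ℝ) * (1 - β) ≤ 2 := by
    have h1 := (div_le_iff₀ hr0).1 hβ
    have h2 := le_max_right 0 ((r : ℝ) - 2)
    linarith
  have hk : (1 : ℝ) ≤ k.factorial := by exact_mod_cast k.factorial_pos
  have hn : (0 : ℝ) < n.factorial := by exact_mod_cast n.factorial_pos
  have h1 : ((n + r * k).factorial : ℝ) / n.factorial ≤
      (2 ^ (n + r * k) * (2 ^ (r ^ 2)) ^ k) * (k.factorial : ℝ) ^ r := by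
    rw [div_le_iff₀ hn]
    have h2 := Nat.add_choose_mul_factorial_mul_factorial n (r * k)
    have h3 : (n + r * k).choose (r * k) ≤ 2 ^ (n + r * k) := Nat.choose_le_two_pow _ _
    have h4 := factorial_mul_le r k
    rw [pow_mul] at h4
    have h5 : (n + r * k).factorial ≤
        (2 ^ (n + r * k) * (2 ^ (r ^ 2)) ^ k) * k.factorial ^ r * n.factorial := by
      rw [← h2]
      calc (n + r * k).choose (r * k) * n.factorial * (r * k).factorial
          ≤ 2 ^ (n + r * k) * n.factorial * ((2 ^ (r ^ 2)) ^ k * k.factorial ^ r) := by gcongr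
        _ = _ := by ring
    exact_mod_cast h5
  have hD : (1 : ℝ) ≤ 2 ^ (n + r * k) * (2 ^ (r ^ 2)) ^ k := by
    rw [← pow_mul, ← pow_add]
    exact one_le_pow₀ one_le_two
  calc (((n + r * k).factorial : ℝ) / n.factorial) ^ (1 - β)
      ≤ ((2 ^ (n + r * k) * (2 ^ (r ^ 2)) ^ k) * (k.factorial : ℝ) ^ r) ^ (1 - β) :=
        Real.rpow_le_rpow (by positivity) h1 (by linarith)
    _ = (2 ^ (n + r * k) * (2 ^ (r ^ 2)) ^ k) ^ (1 - β) *
          (k.factorial : ℝ) ^ ((r : ℝ) * (1 - β)) := by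
        rw [Real.mul_rpow (by positivity) (by positivity), ← Real.rpow_natCast (k.factorial : ℝ),
          ← Real.rpow_mul (by positivity)]
    _ ≤ (2 ^ (n + r * k) * (2 ^ (r ^ 2)) ^ k) ^ (1 : ℝ) * (k.factorial : ℝ) ^ (2 : ℝ) := by
        gcongr
        · linarith
    _ = _ := by rw [Real.rpow_one, Real.rpow_two]

/-- The factor `k! (1/2)^k` is designed for the exponential series: `k!` cancels against `1/k!` and
`(1/2)^k` gives convergence. All other growth is geometric in `n + rk` and goes into `c^{s(n +
rk)}`, with `s` independent of `n` and `k`. -/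
theorem exists_factorial_bound {r : ℕ} (hr : 1 ≤ r) (hβ : max 0 ((r : ℝ) - 2) / r ≤ β)
    (hβ' : β < 1) {C c : ℝ} (hC : 0 ≤ C) (hc : 1 < c) :
    ∃ s : ℕ, ∀ n k : ℕ, (n.factorial : ℝ) ^ (1 + β) *
        (C ^ k * ((n + r * k).factorial / n.factorial)) ^ 2 ≤
      (k.factorial * (1 / 2) ^ k) ^ 2 *
        (((n + r * k).factorial : ℝ) ^ (1 + β) * (c ^ (s * (n + r * k))) ^ 2) := by
  set a := max 1 C with ha
  have ha1 : 1 ≤ a := le_max_left _ _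
  -- The cost per unit of `k`: `a²` for the contractions, `2^{r²}` for `(rk)!`, and `4` for gaining
  -- `(1/2)^{2k}`. The `2` in `2 * D` below comes from the binomial coefficient; `D ≥ 1` and `k ≤ m`
  -- allow `D^k ≤ D^m`.
  set D := a ^ 2 * 2 ^ (r ^ 2) * 4 with hDdef
  have hD1 : 1 ≤ D := by
    have h1 : (1 : ℝ) ≤ a ^ 2 := one_le_pow₀ ha1
    have h2 : (1 : ℝ) ≤ 2 ^ (r ^ 2) := one_le_pow₀ one_le_two
    nlinarith
  obtain ⟨s, hs⟩ := pow_unbounded_of_one_lt (2 * D) hc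
  refine ⟨s, fun n k => ?_⟩
  set m := n + r * k with hm
  have hn : (0 : ℝ) < n.factorial := by exact_mod_cast n.factorial_pos
  have hm0 : (0 : ℝ) < m.factorial := by exact_mod_cast m.factorial_pos
  have hkm : k ≤ m := by nlinarith
  have hX := factorial_ratio_rpow_le hr hβ hβ' n k
  rw [← hm] at hX
  -- Split the square into exponents `1 + β` and `1 - β`; the first moves the weight from degree `n`
  -- to degree `m`.
  have hsplit : (n.factorial : ℝ) ^ (1 + β) * ((m.factorial : ℝ) / n.factorial) ^ 2 =
      (m.factorial : ℝ) ^ (1 + β) * ((m.factorial : ℝ) / n.factorial) ^ (1 - β) := by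
    have h1 : ((m.factorial : ℝ) / n.factorial) ^ 2 =
        ((m.factorial : ℝ) / n.factorial) ^ (1 + β) *
          ((m.factorial : ℝ) / n.factorial) ^ (1 - β) := by
      rw [← Real.rpow_add (by positivity), ← Real.rpow_two]
      norm_num
    rw [h1, ← mul_assoc, ← Real.mul_rpow hn.le (by positivity), mul_div_cancel₀ _ hn.ne']
  have hfin : C ^ k * C ^ k * (2 ^ m * (2 ^ (r ^ 2)) ^ k) * 4 ^ k ≤ (c ^ (s * m)) ^ 2 := by
    calc C ^ k * C ^ k * (2 ^ m * (2 ^ (r ^ 2)) ^ k) * 4 ^ k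
        ≤ a ^ k * a ^ k * (2 ^ m * (2 ^ (r ^ 2)) ^ k) * 4 ^ k := by
          have : C ≤ a := le_max_right _ _
          gcongr
      _ = 2 ^ m * D ^ k := by
          rw [hDdef, mul_pow, mul_pow, sq a, mul_pow]
          ring
      _ ≤ 2 ^ m * D ^ m := by gcongr
      _ = (2 * D) ^ m := (mul_pow _ _ _).symm
      _ ≤ (c ^ s) ^ m := by gcongr
      _ = c ^ (s * m) := (pow_mul _ _ _).symm
      _ ≤ (c ^ (s * m)) ^ 2 := le_self_pow₀ (one_le_pow₀ hc.le) two_ne_zero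
  have h4 : ((1 / 2 : ℝ) ^ k) ^ 2 * 4 ^ k = 1 := by
    rw [← pow_mul, mul_comm k 2, pow_mul, ← mul_pow]
    norm_num
  calc (n.factorial : ℝ) ^ (1 + β) * (C ^ k * (m.factorial / n.factorial)) ^ 2
      = C ^ k * C ^ k *
          ((n.factorial : ℝ) ^ (1 + β) * ((m.factorial : ℝ) / n.factorial) ^ 2) := by ring
    _ = (m.factorial : ℝ) ^ (1 + β) *
          (C ^ k * C ^ k * ((m.factorial : ℝ) / n.factorial) ^ (1 - β)) := by rw [hsplit]; ring
    _ ≤ (m.factorial : ℝ) ^ (1 + β) *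
          (C ^ k * C ^ k * (2 ^ m * (2 ^ (r ^ 2)) ^ k * (k.factorial : ℝ) ^ 2)) := by gcongr
    _ = (m.factorial : ℝ) ^ (1 + β) * (k.factorial : ℝ) ^ 2 * ((1 / 2 : ℝ) ^ k) ^ 2 *
          (C ^ k * C ^ k * (2 ^ m * (2 ^ (r ^ 2)) ^ k) * 4 ^ k) := by
        linear_combination -((m.factorial : ℝ) ^ (1 + β) *
          (C ^ k * C ^ k * (2 ^ m * (2 ^ (r ^ 2)) ^ k * (k.factorial : ℝ) ^ 2))) * h4
    _ ≤ (m.factorial : ℝ) ^ (1 + β) * (k.factorial : ℝ) ^ 2 * ((1 / 2 : ℝ) ^ k) ^ 2 *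
          (c ^ (s * m)) ^ 2 := by gcongr
    _ = _ := by ring

/-- The geometric loss `c^{sm}` is absorbed by passing from `p` to `p + s`, by `exists_gap`. -/
theorem exists_level_bound {r : ℕ} (hr : 1 ≤ r) (hβ : max 0 ((r : ℝ) - 2) / r ≤ β)
    (hβ' : β < 1) {C : ℝ} (hC : 0 ≤ C) :
    ∃ s : ℕ, ∀ (n m k p : ℕ) (_ : m = n + r * k) (g : S.Tensor n) (f : S.Tensor m),
      Koethe.norms ℂ (S.weight n) p g ≤
        C ^ k * (m.factorial / n.factorial) * Koethe.norms ℂ (S.weight m) p f →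
      (n.factorial : ℝ) ^ (1 + β) * Koethe.norms ℂ (S.weight n) p g ^ 2 ≤
        (k.factorial * (1 / 2) ^ k) ^ 2 * ((m.factorial : ℝ) ^ (1 + β) *
          Koethe.norms ℂ (S.weight m) (p + s) f ^ 2) := by
  obtain ⟨c, hc, hgap⟩ := S.exists_gap
  obtain ⟨s, hs⟩ := exists_factorial_bound hr hβ hβ' hC hc
  refine ⟨s, fun n m k p hm g f hgf => ?_⟩
  subst hm
  have hc0 : 0 < c := one_pos.trans hc
  have h1 := hgap _ p s f
  have hg0 : 0 ≤ Koethe.norms ℂ (S.weight n) p g := apply_nonneg _ _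
  have hf0 : 0 ≤ Koethe.norms ℂ (S.weight (n + r * k)) p f := apply_nonneg _ _
  calc (n.factorial : ℝ) ^ (1 + β) * Koethe.norms ℂ (S.weight n) p g ^ 2
      ≤ (n.factorial : ℝ) ^ (1 + β) * (C ^ k * ((n + r * k).factorial / n.factorial) *
          Koethe.norms ℂ (S.weight (n + r * k)) p f) ^ 2 := by gcongr
    _ = (n.factorial : ℝ) ^ (1 + β) * (C ^ k * ((n + r * k).factorial / n.factorial)) ^ 2 *
          Koethe.norms ℂ (S.weight (n + r * k)) p f ^ 2 := by ring
    _ ≤ (k.factorial * (1 / 2) ^ k) ^ 2 * (((n + r * k).factorial : ℝ) ^ (1 + β) *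
          (c ^ (s * (n + r * k))) ^ 2) * Koethe.norms ℂ (S.weight (n + r * k)) p f ^ 2 :=
        mul_le_mul_of_nonneg_right (hs n k) (sq_nonneg _)
    _ = (k.factorial * (1 / 2) ^ k) ^ 2 * (((n + r * k).factorial : ℝ) ^ (1 + β) *
          (c ^ (s * (n + r * k)) * Koethe.norms ℂ (S.weight (n + r * k)) p f) ^ 2) := by ring
    _ ≤ _ := by gcongr

/-! ### Construction of the operators and of their exponentials. -/

theorem exists_integralKernelOperator {r : ℕ} (hr : 1 ≤ r) (κ : S.Dual r)
    (hβ : max 0 ((r : ℝ) - 2) / r ≤ β) (hβ' : β < 1) :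
    ∃ T : S.testFunctions β →L[ℂ] S.testFunctions β, IsIntegralKernelOperator κ T := by
  obtain ⟨q, C, hC, hκ⟩ := exists_norms_contract_le κ
  obtain ⟨s, hs⟩ := exists_level_bound (S := S) hr hβ hβ' hC
  let g : S.testFunctions β → ∀ n, S.Tensor n := fun φ n =>
    ((n + r).factorial / n.factorial : ℂ) • contract rfl κ (chaos φ (n + r))
  have hg : ∀ φ p n, (n.factorial : ℝ) ^ (1 + β) *
      Koethe.norms ℂ (S.weight n) p (g φ n) ^ 2 ≤
        (1 / 2) ^ 2 * (((n + r).factorial : ℝ) ^ (1 + β) *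
          Koethe.norms ℂ (S.weight (n + r)) (max p q + s) (chaos φ (n + r)) ^ 2) := by
    intro φ p n
    -- The case `k = 1`, which explains the constant `1/2`. The level `max p q` is one at which
    -- contraction with `κ` loses nothing.
    have h1 := hs n (n + r) 1 (max p q) (by ring) (g φ n) (chaos φ (n + r)) <| by
      have h2 := hκ n (n + r) (max p q) rfl (chaos φ (n + r)) (le_max_right p q)
      have h3 : ‖((n + r).factorial / n.factorial : ℂ)‖ =
        (n + r).factorial / n.factorial := by
          rw [norm_div, Complex.norm_natCast, Complex.norm_natCast]
      rw [map_smul_eq_mul, h3, pow_one, mul_comm C, mul_assoc]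
      exact mul_le_mul_of_nonneg_left h2 (by positivity)
    have h4 := Tensor.norms_mono n (le_max_left p q) (g φ n)
    have h5 : 0 ≤ Koethe.norms ℂ (S.weight n) p (g φ n) := apply_nonneg _ _
    refine le_trans ?_ (h1.trans_eq (by simp))
    gcongr
  have hsymm : ∀ φ n, IsSymm (g φ n) := fun φ n σ =>
    (map_smul (permute σ) _ _).trans
      (congrArg _ (contract_isSymm rfl κ (chaos_isSymm φ (n + r)) σ))
  have hsum : ∀ φ p, Summable fun n => (n.factorial : ℝ) ^ (1 + β) *
      Koethe.norms ℂ (S.weight n) p (g φ n) ^ 2 := fun φ p =>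
    Summable.of_nonneg_of_le (fun n => by positivity) (hg φ p)
      (((hasSum_fockNorms_sq (max p q + s) φ).summable.comp_injective
        (add_left_injective r)).mul_left _)
  have hadd : ∀ φ ψ n, g (φ + ψ) n = g φ n + g ψ n := fun φ ψ n => by
    simp only [chaos_add, g, map_add, smul_add]
  have hsmul : ∀ (c : ℂ) φ n, g (c • φ) n = c • g φ n := fun c φ n => by
    simp only [chaos_smul, g, map_smul]
    rw [smul_comm]
  let T : S.testFunctions β →ₗ[ℂ] S.testFunctions β :=
    { toFun := fun φ => ofChaos (g φ) (hsymm φ) (hsum φ)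
      map_add' := fun φ ψ => testFunctions_ext (hadd φ ψ)
      map_smul' := fun c φ => testFunctions_ext (hsmul c φ) }
  refine ⟨⟨T, WithSeminorms.continuous_of_isBounded fockWithSeminorms fockWithSeminorms T <|
    Seminorm.IsBounded.of_real fun p => ⟨{max p q + s}, 1 / 2, fun φ => ?_⟩⟩, fun φ n => rfl⟩
  rw [Finset.sup_singleton]
  exact fockNorms_le_of_shift (ψ := T φ) (by norm_num) (hg φ p)

theorem smul_pow_apply (T : S.testFunctions β →L[ℂ] S.testFunctions β) (t : ℂ) (k : ℕ)
    (φ : S.testFunctions β) : ((t • T) ^ k) φ = t ^ k • (T ^ k) φ := by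
  induction k with
  | zero => simp
  | succ k ih =>
    rw [pow_succ', mul_apply_eq_comp, ih, smul_apply, map_smul, smul_smul, pow_succ' T,
      mul_apply_eq_comp, pow_succ']

/-- Iterating the operator telescopes the factorial quotients, so its `k`-th power costs `C^k m!/n!`
at one level. Hence the `k`-th term of the series is bounded by `2^{-k}` times a norm independent of
`k`. -/
theorem exists_exp {r : ℕ} (hr : 1 ≤ r) {κ : S.Dual r} (hβ : max 0 ((r : ℝ) - 2) / r ≤ β)
    (hβ' : β < 1) {T : S.testFunctions β →L[ℂ] S.testFunctions β}
    (hT : IsIntegralKernelOperator κ T) {t : ℂ} (ht : ‖t‖ ≤ 1) : ∃ U, IsExp (t • T) U := by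
  obtain ⟨q, C, hC, hκ⟩ := exists_norms_contract_le κ
  obtain ⟨s, hs⟩ := exists_level_bound (S := S) hr hβ hβ' hC
  have hpow : ∀ (p : ℕ) (φ : S.testFunctions β) (_ : q ≤ p) (k n m : ℕ) (_ : m = n + r * k),
      Koethe.norms ℂ (S.weight n) p (chaos ((T ^ k) φ) n) ≤
        C ^ k * (m.factorial / n.factorial) *
          Koethe.norms ℂ (S.weight m) p (chaos φ m) := by
    intro p φ hp k
    induction k with
    | zero =>
      intro n m hm
      obtain rfl : m = n := by simpa using hm
      have : (m.factorial : ℝ) ≠ 0 := by exact_mod_cast m.factorial_ne_zero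
      simp [div_self this]
    | succ k ih =>
      intro n m hm
      have h1 := ih (n + r) m (by rw [hm]; ring)
      have h2 := hκ n (n + r) p rfl (chaos ((T ^ k) φ) (n + r)) hp
      have h3 : ‖((n + r).factorial / n.factorial : ℂ)‖ =
        (n + r).factorial / n.factorial := by
          rw [norm_div, Complex.norm_natCast, Complex.norm_natCast]
      rw [pow_succ', mul_apply_eq_comp, hT, map_smul_eq_mul, h3]
      have hn : (0 : ℝ) < (n + r).factorial := by exact_mod_cast (n + r).factorial_pos
      calc ((n + r).factorial / n.factorial : ℝ) *
            Koethe.norms ℂ (S.weight n) p (contract rfl κ (chaos ((T ^ k) φ) (n + r)))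
          ≤ ((n + r).factorial / n.factorial : ℝ) * (C * (C ^ k *
              (m.factorial / (n + r).factorial) *
                Koethe.norms ℂ (S.weight m) p (chaos φ m))) := by
            refine mul_le_mul_of_nonneg_left (h2.trans ?_) (by positivity)
            exact mul_le_mul_of_nonneg_left h1 hC
        _ = _ := by
            field_simp
            ring
  refine exists_hasSum_operators fockWithSeminorms exists_hasSum_testFunctions _
    (fun k => (1 / 2 : ℝ) ^ k) summable_geometric_two fun p =>
      ⟨max p q + s, fun k φ => ?_⟩
  have hk : (0 : ℝ) < k.factorial := by exact_mod_cast k.factorial_pos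
  have hTk : S.fockNorms β (max p q) ((T ^ k) φ) ≤
      (k.factorial * (1 / 2) ^ k) * S.fockNorms β (max p q + s) φ :=
    fockNorms_le_of_shift (d := r * k) (by positivity) fun n =>
      hs n (n + r * k) k (max p q) rfl _ _ (hpow (max p q) φ (le_max_right p q) k n _ rfl)
  have hTp := fockNorms_mono (le_max_left p q) ((T ^ k) φ)
  rw [smul_apply, smul_pow_apply, smul_smul, map_smul_eq_mul, norm_mul, norm_inv,
    Complex.norm_natCast, norm_pow]
  have ht' : ‖t‖ ^ k ≤ 1 := pow_le_one₀ (norm_nonneg t) ht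
  have h0 : 0 ≤ S.fockNorms β p ((T ^ k) φ) := apply_nonneg _ _
  calc (k.factorial : ℝ)⁻¹ * ‖t‖ ^ k * S.fockNorms β p ((T ^ k) φ)
      ≤ (k.factorial : ℝ)⁻¹ * 1 *
          ((k.factorial * (1 / 2) ^ k) * S.fockNorms β (max p q + s) φ) := by
        gcongr
        exact hTp.trans hTk
    _ = _ := by field_simp

/-! ### Wick tensors and exponentials of integral kernel operators -/

/-- The quotient `(n + r)!/n!` turns the coefficient `1/(n + r)!` into `1/n!`, so exponential
vectors are eigenvectors. -/
theorem IsIntegralKernelOperator.apply_expVec {r : ℕ} {κ : S.Dual r}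
    {T : S.testFunctions β →L[ℂ] S.testFunctions β} (hT : IsIntegralKernelOperator κ T)
    (hβ : β < 1) (z : S.Vec) :
    T (expVec hβ z) = κ (vecPow z r) • expVec hβ z := testFunctions_ext fun n => by
  have h1 : ((n + r).factorial : ℂ) ≠ 0 := by exact_mod_cast (n + r).factorial_ne_zero
  rw [hT, chaos_smul, chaos_expVec, chaos_expVec, map_smul, contract_vecPow, smul_smul, smul_smul,
    smul_smul]
  congr 1
  field_simp

theorem IsExp.hasSum_apply {T U : S.testFunctions β →L[ℂ] S.testFunctions β} (h : IsExp T U)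
    (φ : S.testFunctions β) : HasSum (fun k : ℕ => (k.factorial : ℂ)⁻¹ • (T ^ k) φ) (U φ) :=
  HasSum.map h (⟨⟨fun T => T φ, rfl⟩, fun _ _ => rfl⟩ :
    (S.testFunctions β →L[ℂ] S.testFunctions β) →+ S.testFunctions β)
    (ContinuousEvalConst.continuous_eval_const φ)

theorem IsExp.apply_expVec {r : ℕ} {κ : S.Dual r}
    {T U : S.testFunctions β →L[ℂ] S.testFunctions β} (hT : IsIntegralKernelOperator κ T)
    {t : ℂ} (hU : IsExp (t • T) U) (hβ : β < 1) (z : S.Vec) :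
    U (expVec hβ z) = Complex.exp (t * κ (vecPow z r)) • expVec hβ z := by
  refine (hU.hasSum_apply _).unique ?_
  rw [Complex.exp_eq_exp_ℂ]
  refine ((NormedSpace.expSeries_div_hasSum_exp (t * κ (vecPow z r))).smul_const
    (expVec hβ z)).congr_fun fun k => ?_
  have h : (T ^ k) (expVec hβ z) = κ (vecPow z r) ^ k • expVec hβ z := by
    induction k with
    | zero => simp
    | succ k ih =>
      rw [pow_succ', mul_apply_eq_comp, ih, map_smul, hT.apply_expVec, smul_smul, pow_succ]
  rw [smul_pow_apply, h, smul_smul, smul_smul, mul_pow]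
  congr 1
  ring

/-- The exponentials of multiples of `Ξ_{0,r}(κ)` with opposite factors are inverse to each
other. -/
theorem IsExp.apply_apply_neg {r : ℕ} {κ : S.Dual r}
    {T U U' : S.testFunctions β →L[ℂ] S.testFunctions β} (hT : IsIntegralKernelOperator κ T)
    {t : ℂ} (hU : IsExp (t • T) U) (hU' : IsExp (-t • T) U') (hβ : β < 1)
    (φ : S.testFunctions β) : U (U' φ) = φ := by
  have h : U.comp U' = ContinuousLinearMap.id ℂ _ := operator_ext hβ fun s => by
    rw [ContinuousLinearMap.comp_apply, hU'.apply_expVec hT, map_smul, hU.apply_expVec hT,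
      smul_smul, ← Complex.exp_add]
    simp
  exact DFunLike.congr_fun h φ

/-- The exponentials of integral kernel operators commute. -/
theorem IsExp.commute {r r' : ℕ} {κ : S.Dual r} {κ' : S.Dual r'}
    {T T' U U' : S.testFunctions β →L[ℂ] S.testFunctions β} (hT : IsIntegralKernelOperator κ T)
    (hT' : IsIntegralKernelOperator κ' T') {t t' : ℂ} (hU : IsExp (t • T) U)
    (hU' : IsExp (t' • T') U') (hβ : β < 1) (φ : S.testFunctions β) : U (U' φ) = U' (U φ) := by
  have h : U.comp U' = U'.comp U := operator_ext hβ fun s => by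
    rw [ContinuousLinearMap.comp_apply, ContinuousLinearMap.comp_apply, hU'.apply_expVec hT',
      hU.apply_expVec hT, map_smul, map_smul, hU.apply_expVec hT, hU'.apply_expVec hT', smul_comm]
  exact DFunLike.congr_fun h φ

theorem IsIntegralKernelOperator.apply_emb {r : ℕ} {κ : S.Dual r}
    {T : S.testFunctions β →L[ℂ] S.testFunctions β} (hT : IsIntegralKernelOperator κ T)
    (z : S.Vec) (m : ℕ) :
    T (((m + r).factorial : ℂ)⁻¹ • S.emb β (m + r) (vecPow z (m + r))) =
      κ (vecPow z r) • ((m.factorial : ℂ)⁻¹ • S.emb β m (vecPow z m)) :=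
  testFunctions_ext fun n => by
    rw [hT, chaos_smul, chaos_smul, chaos_smul]
    rcases eq_or_ne n m with rfl | h
    · have h1 : ((n + r).factorial : ℂ) ≠ 0 := by exact_mod_cast (n + r).factorial_ne_zero
      rw [chaos_emb_self, chaos_emb_self, symPart_eq (vecPow_isSymm z _),
        symPart_eq (vecPow_isSymm z _), map_smul, contract_vecPow, smul_smul, smul_smul, smul_smul]
      congr 1
      field_simp
    · rw [chaos_emb_of_ne h, chaos_emb_of_ne (fun h' => h (Nat.add_right_cancel h'))]
      simp only [smul_zero, map_zero]

theorem IsIntegralKernelOperator.apply_emb_of_lt {r : ℕ} {κ : S.Dual r}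
    {T : S.testFunctions β →L[ℂ] S.testFunctions β} (hT : IsIntegralKernelOperator κ T)
    {m : ℕ} (hm : m < r) (f : S.Tensor m) : T (S.emb β m f) = 0 := testFunctions_ext fun n => by
  rw [hT, chaos_emb_of_ne (by omega), map_zero, smul_zero]
  rfl

/-- With the normalization `z^{⊗m}/m!` each application lowers the degree by `r` and multiplies by
`κ(z^{⊗r})`, without factorials, until the degree drops below `r`. -/
theorem IsIntegralKernelOperator.pow_apply_emb {r : ℕ} {κ : S.Dual r}
    {T : S.testFunctions β →L[ℂ] S.testFunctions β} (hT : IsIntegralKernelOperator κ T)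
    (z : S.Vec) (m k : ℕ) :
    (T ^ k) ((m.factorial : ℂ)⁻¹ • S.emb β m (vecPow z m)) =
      if r * k ≤ m then κ (vecPow z r) ^ k •
        (((m - r * k).factorial : ℂ)⁻¹ • S.emb β (m - r * k) (vecPow z (m - r * k))) else 0 := by
  induction k with
  | zero => simp
  | succ k ih =>
    rw [pow_succ', mul_apply_eq_comp, ih]
    have hk : r * (k + 1) = r * k + r := by ring
    by_cases h1 : r * k ≤ m
    · rw [if_pos h1, map_smul]
      by_cases h2 : r * (k + 1) ≤ m
      · obtain ⟨d, rfl⟩ : ∃ d, m = d + r + r * k := ⟨m - r * (k + 1), by omega⟩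
        have e1 : d + r + r * k - r * k = d + r := by omega
        have e2 : d + r + r * k - r * (k + 1) = d := by omega
        rw [if_pos h2, e1, e2, hT.apply_emb, smul_smul, pow_succ]
      · rw [if_neg h2, map_smul, hT.apply_emb_of_lt (by omega), smul_zero, smul_zero]
    · rw [if_neg h1, if_neg (by omega), map_zero]

/-- On degree `m` the exponential series stops at `k = m / r`. For `t = -½` its terms are those of
the generalized Wick tensor at `z^{⊗m}`. -/
theorem evalAt_exp_vecPow (hβ : 0 ≤ β) {r : ℕ} (hr : 1 ≤ r) {κ : S.Dual r}
    {T U : S.testFunctions β →L[ℂ] S.testFunctions β} (hT : IsIntegralKernelOperator κ T)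
    {t : ℂ} (hU : IsExp (t • T) U) (x : S.DualSpace) (z : S.Vec) (m : ℕ) :
    evalAt hβ x (U (S.emb β m (vecPow z m))) = ∑ k ∈ Finset.range (m / r + 1),
      (m.factorial : ℂ) / ((m - r * k).factorial * k.factorial) * t ^ k *
        (dualPair x z ^ (m - r * k) * κ (vecPow z r) ^ k) := by
  have hm : (m.factorial : ℂ) ≠ 0 := by exact_mod_cast m.factorial_ne_zero
  have h1 := ((hU.hasSum_apply ((m.factorial : ℂ)⁻¹ • S.emb β m (vecPow z m))).mapL
    (evalAt hβ x)).mul_left (m.factorial : ℂ)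
  rw [map_smul, map_smul, smul_eq_mul, mul_inv_cancel_left₀ hm] at h1
  have hle : ∀ k, k ∈ Finset.range (m / r + 1) ↔ r * k ≤ m := fun k => by
    rw [Finset.mem_range, Nat.lt_succ_iff, Nat.le_div_iff_mul_le hr, mul_comm]
  have hterm : ∀ k : ℕ, (m.factorial : ℂ) * evalAt hβ x ((k.factorial : ℂ)⁻¹ •
      ((t • T) ^ k) ((m.factorial : ℂ)⁻¹ • S.emb β m (vecPow z m))) =
      if r * k ≤ m then (m.factorial : ℂ) / ((m - r * k).factorial * k.factorial) * t ^ k *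
        (dualPair x z ^ (m - r * k) * κ (vecPow z r) ^ k) else 0 := by
    intro k
    rw [smul_pow_apply, hT.pow_apply_emb]
    split_ifs with h
    · simp only [map_smul, smul_eq_mul]
      rw [evalAt_emb hβ x (vecPow_isSymm z _), pointPow_vecPow]
      field_simp
    · simp
  have h2 := hasSum_sum_of_ne_finset_zero (L := .unconditional ℕ)
    (f := fun k : ℕ => (m.factorial : ℂ) * evalAt hβ x
      ((k.factorial : ℂ)⁻¹ • ((t • T) ^ k) ((m.factorial : ℂ)⁻¹ • S.emb β m (vecPow z m))))
    (s := Finset.range (m / r + 1)) fun k hk => by rw [hterm, if_neg (mt (hle k).2 hk)]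
  rw [h1.unique h2]
  exact Finset.sum_congr rfl fun k hk => by rw [hterm, if_pos ((hle k).1 hk)]

theorem genWick_permute {r : ℕ} (κ : S.Dual r) (x : S.DualSpace) (m : ℕ) :
    IsSymmDual (genWick κ x m) := fun σ f => by
  simp only [genWick, sum_apply, smul_apply, symTensor, symmetrize_permute]

theorem wick_permute (x : S.DualSpace) (m : ℕ) : IsSymmDual (wick x m) := fun σ f => by
  simp only [wick, sum_apply, smul_apply, symTensor, symmetrize_permute]

theorem genWick_vecPow {r : ℕ} (κ : S.Dual r) (x : S.DualSpace) (m : ℕ) (z : S.Vec) :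
    genWick κ x m (vecPow z m) = ∑ k ∈ Finset.range (m / r + 1),
      (m.factorial : ℂ) / ((m - r * k).factorial * k.factorial) * (-(1 / 2)) ^ k *
        (dualPair x z ^ (m - r * k) * κ (vecPow z r) ^ k) := by
  rw [← Fin.sum_univ_eq_sum_range (fun k => (m.factorial : ℂ) /
    ((m - r * k).factorial * k.factorial) * (-(1 / 2)) ^ k *
        (dualPair x z ^ (m - r * k) * κ (vecPow z r) ^ k))]
  simp only [genWick, sum_apply, smul_apply, symTensor, symTensorPow, symmetrize_vecPow,
    tensor_vecPow, pointPow_vecPow, tensorPow_vecPow, smul_eq_mul]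

theorem wick_coeff_eq {m k : ℕ} (h : 2 * k ≤ m) :
    (m.choose (2 * k) : ℂ) * (Nat.doubleFactorial (2 * k - 1) : ℂ) * (-1) ^ k =
      (m.factorial : ℂ) / ((m - 2 * k).factorial * k.factorial) * (-(1 / 2)) ^ k := by
  have h1 : (2 * k).factorial = 2 ^ k * k.factorial * Nat.doubleFactorial (2 * k - 1) := by
    -- For `k = 0` the truncated subtraction gives `0‼ = 1`, in accordance with the convention
    -- `(-1)!! = 1`.
    rcases k with _ | k
    · simp
    · rw [← Nat.doubleFactorial_two_mul]
      exact Nat.factorial_eq_mul_doubleFactorial (2 * k + 1)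
  have h2 := Nat.choose_mul_factorial_mul_factorial h
  rw [h1] at h2
  have h3 : (m.choose (2 * k) : ℂ) * (2 ^ k * k.factorial * Nat.doubleFactorial (2 * k - 1)) *
    (m - 2 * k).factorial = m.factorial := by exact_mod_cast h2
  have h4 : ((m - 2 * k).factorial : ℂ) ≠ 0 := by exact_mod_cast (m - 2 * k).factorial_ne_zero
  have h5 : (k.factorial : ℂ) ≠ 0 := by exact_mod_cast k.factorial_ne_zero
  rw [← h3, neg_pow (1 / 2 : ℂ), div_pow, one_pow]
  field_simp

/-- Both sides are symmetric functionals, so powers suffice. There the symmetrization of `τ^{⊗k}`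
makes no difference and only the coefficients have to agree. -/
theorem genWick_trace (x : S.DualSpace) (m : ℕ) : genWick trace x m = wick x m := by
  refine sub_eq_zero.1 (dual_eq_zero (fun σ f => ?_) fun t => ?_)
  · rw [sub_apply, sub_apply, genWick_permute, wick_permute]
  · rw [sub_apply, sub_eq_zero]
    simp only [genWick, wick, sum_apply, smul_apply, symTensor, symTensorPow, symmetrize_vecPow,
      tensor_vecPow]
    exact Finset.sum_congr rfl fun k _ => by rw [wick_coeff_eq (mul_le_of_fin k)]

/-- Both sides are symmetric functionals of `f` that agree on powers. Non-symmetric `f` is allowed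
because `emb` symmetrizes. -/
theorem evalAt_exp_emb (hβ : 0 ≤ β) {r : ℕ} (hr : 1 ≤ r) {κ : S.Dual r}
    {T U : S.testFunctions β →L[ℂ] S.testFunctions β} (hT : IsIntegralKernelOperator κ T)
    (hU : IsExp (-(1 / 2 : ℂ) • T) U) (x : S.DualSpace) (m : ℕ) (f : S.Tensor m) :
    evalAt hβ x (U (S.emb β m f)) = genWick κ x m f := by
  have h : ((evalAt hβ x).comp U).comp (S.emb β m) - genWick κ x m = 0 := by
    refine dual_eq_zero (fun σ f => ?_) fun t => ?_
    · rw [sub_apply, sub_apply, genWick_permute, ContinuousLinearMap.comp_apply, emb_permute]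
      rfl
    · rw [sub_apply, sub_eq_zero, genWick_vecPow]
      exact evalAt_exp_vecPow hβ hr hT hU x _ m
  exact sub_eq_zero.1 (DFunLike.congr_fun h f)

/-- If `U = exp(-½ Δ_G)`, then the function of `φ` is the power series of `U φ`. -/
theorem isFunction_iff (hβ : 0 ≤ β) {D U : S.testFunctions β →L[ℂ] S.testFunctions β}
    (hD : IsIntegralKernelOperator trace D) (hU : IsExp (-(1 / 2 : ℂ) • D) U)
    {φ : S.testFunctions β} {F : S.DualSpace → ℂ} :
    IsFunction φ F ↔ ∀ x, evalAt hβ x (U φ) = F x := by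
  have h : ∀ x, HasSum (fun n => wick x n (chaos φ n)) (evalAt hβ x (U φ)) := fun x =>
    ((hasSum_emb_chaos φ).mapL ((evalAt hβ x).comp U)).congr_fun fun n => by
      rw [ContinuousLinearMap.comp_apply, evalAt_exp_emb hβ one_le_two hD hU, genWick_trace]
  exact ⟨fun hF x => (h x).unique (hF x), fun hF x => hF x ▸ h x⟩

/-! ### Inversion of Wick ordering and the renormalization operator. -/

theorem exists_trace_exp (hβ : 0 ≤ β) (hβ' : β < 1) :
    ∃ D U U' : S.testFunctions β →L[ℂ] S.testFunctions β, IsIntegralKernelOperator trace D ∧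
      IsExp (-(1 / 2 : ℂ) • D) U ∧ (∀ φ, U (U' φ) = φ) ∧ ∀ φ, U' (U φ) = φ := by
  -- For `r = 2` the condition on `β` is just `0 ≤ β`.
  have h2 : max 0 (((2 : ℕ) : ℝ) - 2) / (2 : ℕ) ≤ β := by simpa using hβ
  obtain ⟨D, hD⟩ := exists_integralKernelOperator one_le_two (trace (S := S)) h2 hβ'
  obtain ⟨U, hU⟩ := exists_exp one_le_two h2 hβ' hD (t := -(1 / 2 : ℂ)) (by norm_num)
  obtain ⟨U', hU'⟩ := exists_exp one_le_two h2 hβ' hD (t := (1 / 2 : ℂ)) (by norm_num)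
  refine ⟨D, U, U', hD, hU, fun φ => ?_, fun φ => hU'.apply_apply_neg hD hU hβ' φ⟩
  exact hU.apply_apply_neg hD (by rwa [neg_neg]) hβ' φ

/-- The function of `φ` is the power series of `U φ`, and power series determine their coefficients;
hence `U φ = ψ`. -/
theorem isFunction_iff_eq (hβ : 0 ≤ β) {D U U' : S.testFunctions β →L[ℂ] S.testFunctions β}
    (hD : IsIntegralKernelOperator trace D) (hU : IsExp (-(1 / 2 : ℂ) • D) U)
    (hUU' : ∀ φ, U (U' φ) = φ) (hU'U : ∀ φ, U' (U φ) = φ) {ψ : S.testFunctions β}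
    {F : S.DualSpace → ℂ} (hF : ∀ x, evalAt hβ x ψ = F x) {φ : S.testFunctions β} :
    IsFunction φ F ↔ φ = U' ψ := by
  rw [isFunction_iff hβ hD hU]
  refine ⟨fun h => ?_, fun h x => by rw [h, hUU', hF]⟩
  rw [← hU'U φ]
  congr 1
  refine sub_eq_zero.1 (eq_zero_of_evalAt hβ fun x => ?_)
  rw [map_sub, h, hF, sub_self]

/-- The exponential function belongs to `U' Φ_ζ` and to no other test function. So the defining
property says that `Θ U'` fixes the exponential vectors; for uniqueness the real finitely supported
`ζ` suffice, as these are already total. -/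
theorem isRenormalization_iff {D U U' : S.testFunctions 0 →L[ℂ] S.testFunctions 0}
    (hD : IsIntegralKernelOperator trace D) (hU : IsExp (-(1 / 2 : ℂ) • D) U)
    (hUU' : ∀ φ, U (U' φ) = φ) (hU'U : ∀ φ, U' (U φ) = φ)
    {Θ : S.testFunctions 0 →L[ℂ] S.testFunctions 0} : IsRenormalization Θ ↔ Θ = U := by
  have hfun : ∀ (ξ η : S.TestSpace) (φ : S.testFunctions 0),
      IsFunction φ (fun x => Complex.exp ((x ξ : ℂ) + Complex.I * (x η : ℂ))) ↔
        φ = U' (expVec one_pos (complexVec ξ η)) := fun ξ η φ =>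
    isFunction_iff_eq le_rfl hD hU hUU' hU'U fun x => by
      rw [evalAt_expVec, dualPair_complexVec]
  constructor
  · intro h
    have hc : Θ.comp U' = ContinuousLinearMap.id ℂ _ := operator_ext one_pos fun t => by
      obtain ⟨ξ, hξ⟩ := exists_complexVec_eq_finVec t
      obtain ⟨φ, hφ, hΘ⟩ := h ξ 0
      rw [hfun] at hφ
      rw [isExpVector_iff one_pos, hφ, hξ] at hΘ
      exact hΘ
    ext1 φ
    rw [← hU'U φ]
    refine (DFunLike.congr_fun hc (U φ)).trans ?_
    rw [hU'U]
    rfl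
  · rintro rfl ξ η
    exact ⟨_, (hfun ξ η _).2 rfl, (isExpVector_iff one_pos).2 (hUU' _)⟩

end Eigenbasis

/-! ### The eigenbasis of a white noise operator -/

section HilbertSchmidt

variable {H : Type} [NormedAddCommGroup H] [InnerProductSpace ℝ H]

theorem hasSum_inner_sq {γ : Type} (b : HilbertBasis γ ℝ H) (x : H) :
    HasSum (fun i => (inner ℝ (b i) x) ^ 2) (‖x‖ ^ 2) := by
  have h := b.hasSum_inner_mul_inner x x
  rw [real_inner_self_eq_norm_sq] at h
  refine h.congr_fun fun i => ?_
  rw [real_inner_comm x (b i), sq]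

/-- A Hilbert-Schmidt operator is compact. -/
theorem isCompactOperator_of_summable_sq [CompleteSpace H] {γ : Type} (b : HilbertBasis γ ℝ H) (R : H →L[ℝ] H)
    (hR : Summable fun i => ‖R (b i)‖ ^ 2) : IsCompactOperator R := by
  -- Finite rank truncations; by Cauchy–Schwarz their distance to `R` is at most the square root of
  -- a tail of `∑ ‖R bᵢ‖²`.
  let F : Finset γ → H →L[ℝ] H := fun s => ∑ i ∈ s, (innerSL ℝ (b i)).smulRight (R (b i))
  have hF : ∀ s, IsCompactOperator (F s) := fun s => by
    have : F s ∈ compactOperator (RingHom.id ℝ) H H := by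
      refine Submodule.sum_mem _ fun i _ => ?_
      exact (isCompactOperator_of_locallyCompactSpace_dom (innerSL ℝ (b i))).clm_comp
        (ContinuousLinearMap.toSpanSingleton ℝ (R (b i)))
    exact this
  refine isCompactOperator_of_tendsto (l := Filter.atTop) (F := F) ?_ (Filter.Eventually.of_forall hF)
  rw [tendsto_iff_norm_sub_tendsto_zero]
  have ht := (Real.continuous_sqrt.tendsto 0).comp
    (tendsto_tsum_compl_atTop_zero fun i => ‖R (b i)‖ ^ 2)
  rw [Real.sqrt_zero] at ht
  refine squeeze_zero (fun s => norm_nonneg _) (fun s => ?_) ht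
  rw [norm_sub_rev]
  refine ContinuousLinearMap.opNorm_le_bound _ (Real.sqrt_nonneg _) fun h => ?_
  have h1 : HasSum (fun i : {i // i ∉ s} => inner ℝ (b i) h • R (b i)) ((R - F s) h) := by
    refine (s.hasSum_compl_iff (f := fun i => inner ℝ (b i) h • R (b i))).2 ?_
    have h2 := (b.hasSum_repr h).mapL R
    have h3 : (R - F s) h + ∑ i ∈ s, inner ℝ (b i) h • R (b i) = R h := by
      simp [F, sum_apply]
    rw [h3]
    refine h2.congr_fun fun i => ?_
    rw [map_smul, b.repr_apply_apply]
  have hb := (hasSum_inner_sq b h)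
  have hb' : Summable fun i : {i // i ∉ s} => ‖inner ℝ (b i) h‖ ^ 2 :=
    (hb.summable.subtype {i | i ∉ s}).congr fun i => by simp
  obtain ⟨h4, h5⟩ := summable_mul_and_le (a := fun i : {i // i ∉ s} => ‖R (b i)‖)
    (b := fun i : {i // i ∉ s} => ‖inner ℝ (b i) h‖) (fun _ => norm_nonneg _)
    (fun _ => norm_nonneg _) (hR.subtype {i | i ∉ s}) hb'
  rw [← h1.tsum_eq]
  have h6 : ∀ i : {i // i ∉ s}, ‖inner ℝ (b i) h • R (b i)‖ =
      ‖R (b i)‖ * ‖inner ℝ (b i) h‖ := fun i => by rw [norm_smul, mul_comm]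
  refine (norm_tsum_le_tsum_norm (h4.congr fun i => (h6 i).symm)).trans ?_
  rw [tsum_congr h6]
  refine h5.trans (mul_le_mul_of_nonneg_left ?_ (Real.sqrt_nonneg _))
  refine Real.sqrt_le_iff.2 ⟨norm_nonneg _, ?_⟩
  rw [← hb.tsum_eq]
  refine le_trans (le_of_eq (tsum_congr fun i => by simp)) (hb.summable.tsum_subtype_le
    (fun i => (inner ℝ (b i) h) ^ 2) {i | i ∉ s} fun i => sq_nonneg _)

/-- The Hilbert-Schmidt property of a symmetric operator does not depend on the basis. -/
theorem summable_norm_sq_of_symmetric {γ δ : Type} (b : HilbertBasis γ ℝ H)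
    (e : HilbertBasis δ ℝ H) {R : H →L[ℝ] H} (hs : ∀ x y, inner ℝ (R x) y = inner ℝ x (R y))
    (hR : Summable fun i => ‖R (b i)‖ ^ 2) : Summable fun j => ‖R (e j)‖ ^ 2 := by
  -- The double series of squared matrix entries is summed in both orders; symmetry of `R`
  -- identifies the second order.
  have h1 : Summable fun x : γ × δ => (inner ℝ (e x.2) (R (b x.1))) ^ 2 := by
    refine (summable_prod_of_nonneg fun x => sq_nonneg _).2 ⟨fun i => ?_, ?_⟩
    · exact (hasSum_inner_sq e (R (b i))).summable
    · exact hR.congr fun i => (hasSum_inner_sq e (R (b i))).tsum_eq.symm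
  have h2 := h1.prod_symm.prod
  refine h2.congr fun j => ?_
  rw [← (hasSum_inner_sq b (R (e j))).tsum_eq]
  refine tsum_congr fun i => ?_
  rw [Prod.fst_swap, Prod.snd_swap, ← hs, real_inner_comm]

/-- A compact symmetric operator has an orthonormal basis of eigenvectors. -/
theorem exists_eigenbasis_of_compact [CompleteSpace H] {R : H →L[ℝ] H} (hc : IsCompactOperator R)
    (hs : ∀ x y, inner ℝ (R x) y = inner ℝ x (R y)) :
    ∃ (γ : Type) (μ : γ → ℝ) (e : HilbertBasis γ ℝ H), ∀ j, R (e j) = μ j • e j := by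
  have hsym : (R : H →ₗ[ℝ] H).IsSymmetric := hs
  let G : ℝ → Submodule ℝ H := fun μ => Module.End.eigenspace (R : Module.End ℝ H) μ
  have hclosed : ∀ μ, IsClosed (G μ : Set H) := fun μ => by
    have : (G μ : Set H) = {x | R x = μ • x} := by
      ext x
      exact Module.End.mem_eigenspace_iff
    rw [this]
    exact isClosed_eq R.continuous (continuous_const_smul μ)
  have hcomplete : ∀ μ, CompleteSpace (G μ) := fun μ => (hclosed μ).completeSpace_coe
  -- Hilbert bases of all eigenspaces are glued. A vector orthogonal to all of them is orthogonal to
  -- every eigenspace, hence zero by the spectral theorem.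
  choose w b _ using fun μ => exists_hilbertBasis ℝ (G μ)
  let v : (Σ μ, w μ) → H := fun a => (b a.1 a.2 : H)
  have hon : Orthonormal ℝ v := hsym.orthogonalFamily_eigenspaces.orthonormal_sigma_orthonormal
    (v_family := fun μ => b μ) fun μ => (b μ).orthonormal
  have hbot : (Submodule.span ℝ (Set.range v))ᗮ = ⊥ := by
    rw [eq_bot_iff, ← ContinuousLinearMap.orthogonalComplement_iSup_eigenspaces_eq_bot hc hsym]
    intro x hx
    rw [← Submodule.iInf_orthogonal, Submodule.mem_iInf]
    intro μ y hy
    have h1 := ((b μ).hasSum_repr ⟨y, hy⟩).mapL ((innerSL ℝ x).comp (G μ).subtypeL)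
    have h2 : inner ℝ x y = 0 := by
      refine h1.unique (hasSum_zero.congr_fun fun i => ?_)
      have h3 : inner ℝ (v ⟨μ, i⟩) x = 0 := hx _ (Submodule.subset_span ⟨⟨μ, i⟩, rfl⟩)
      have h4 : ((innerSL ℝ x).comp (G μ).subtypeL) (b μ i) = inner ℝ x (v ⟨μ, i⟩) := rfl
      rw [map_smul, h4, real_inner_comm, h3, smul_zero]
    rw [real_inner_comm]
    exact h2
  refine ⟨Σ μ, w μ, Sigma.fst, HilbertBasis.mkOfOrthogonalEqBot hon hbot, fun j => ?_⟩
  rw [HilbertBasis.coe_mkOfOrthogonalEqBot]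
  exact Module.End.mem_eigenspace_iff.1 (b j.1 j.2).2

end HilbertSchmidt

/-- The inverse `R` is symmetric because `A` is self-adjoint, and compact because it is
Hilbert–Schmidt. Its eigenvalues `μ` are nonzero since `R` is injective, and `1/μ` is an eigenvalue
of `A`, hence in the spectrum and at least `c > 1`. Summability of `λ⁻²` is the Hilbert–Schmidt
property in the eigenbasis. -/
theorem IsWhiteNoiseOperator.nonempty_eigenbasis {A : RealL2 →ₗ.[ℝ] RealL2}
    (hA : IsWhiteNoiseOperator A) : Nonempty (Eigenbasis A) := by
  obtain ⟨R, hR, b, hb⟩ := hA.hilbertSchmidt_inverse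
  have hAR : ∀ h, A ⟨R h, hR.mem_domain h⟩ = h := fun h => by
    have := hR.right_inv h
    rwa [zero_smul, sub_zero] at this
  have hs : ∀ x y, inner ℝ (R x) y = inner ℝ x (R y) := fun x y => by
    have h1 := LinearPMap.adjoint_isFormalAdjoint hA.selfAdjoint.dense_domain
    rw [LinearPMap.isSelfAdjoint_def.1 hA.selfAdjoint] at h1
    have h2 := h1 ⟨R x, hR.mem_domain x⟩ ⟨R y, hR.mem_domain y⟩
    rw [hAR, hAR] at h2
    exact h2.symm
  obtain ⟨γ, μ, e, he⟩ := exists_eigenbasis_of_compact (isCompactOperator_of_summable_sq b R hb) hs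
  have hne : ∀ j, e j ≠ 0 := fun j => e.orthonormal.ne_zero j
  have hμ : ∀ j, μ j ≠ 0 := fun j hj => hne j <| by
    have h1 : R (e j) = 0 := by rw [he, hj, zero_smul]
    have h2 : (⟨R (e j), hR.mem_domain _⟩ : A.domain) = 0 := Subtype.ext h1
    rw [← hAR (e j), h2]
    exact A.map_zero
  have heq : ∀ j, R ((μ j)⁻¹ • e j) = e j := fun j => by
    rw [map_smul, he, inv_smul_smul₀ (hμ j)]
  have hmem : ∀ j, e j ∈ A.domain := fun j => heq j ▸ hR.mem_domain _
  have happly : ∀ j, A ⟨e j, hmem j⟩ = (μ j)⁻¹ • e j := fun j => by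
    have h1 : (⟨e j, hmem j⟩ : A.domain) = ⟨R ((μ j)⁻¹ • e j), hR.mem_domain _⟩ :=
      Subtype.ext (heq j).symm
    rw [h1, hAR]
  refine ⟨⟨γ, e, fun j => (μ j)⁻¹, hmem, happly, ?_, ?_⟩⟩
  · obtain ⟨c, hc, hspec⟩ := hA.one_lt_inf_spectrum
    refine ⟨c, hc, fun j => hspec _ ?_⟩
    rintro ⟨Q, hQ⟩
    have h1 := hQ.left_inv ⟨e j, hmem j⟩
    rw [happly, sub_self, map_zero] at h1
    exact hne j h1.symm
  · refine (summable_norm_sq_of_symmetric b e hs hb).congr fun j => ?_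
    rw [he, norm_smul, e.orthonormal.1 j, mul_one, inv_pow, inv_inv, Real.norm_eq_abs, sq_abs]

end WhiteNoise

end

/-! ### The theorem. -/

open WhiteNoise WhiteNoise.Eigenbasis

theorem mainTheorem8 (A : RealL2 →ₗ.[ℝ] RealL2) (hA : IsWhiteNoiseOperator A) :
    Nonempty (Eigenbasis A) ∧ ∀ S : Eigenbasis A,
      (∀ (r : ℕ), 1 ≤ r → ∀ κ : S.Dual r, IsSymmDual κ →
        ∀ β : ℝ, max 0 ((r : ℝ) - 2) / r ≤ β → β < 1 →
          ∃ Ξ T : S.testFunctions β →L[ℂ] S.testFunctions β,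
            IsIntegralKernelOperator κ Ξ ∧ IsExp (-(1 / 2 : ℂ) • Ξ) T ∧
            ∀ (m : ℕ) (f : S.Tensor m), IsSymm f →
              (∃! φ : S.testFunctions β, IsFunction φ fun x => pointPow x m f) ∧
              ∀ φ : S.testFunctions β, (IsFunction φ fun x => pointPow x m f) →
                IsFunction (T φ) fun x => genWick κ x m f) ∧
      (∀ (x : S.DualSpace) (m : ℕ), genWick trace x m = wick x m) ∧
      ∃ ΔG Θ : S.testFunctions 0 →L[ℂ] S.testFunctions 0,
        IsIntegralKernelOperator trace ΔG ∧ IsExp (-(1 / 2 : ℂ) • ΔG) Θ ∧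
        IsRenormalization Θ ∧ (∀ Θ', IsRenormalization Θ' → Θ' = Θ) ∧
        ∀ (m : ℕ) (f : S.Tensor m), IsSymm f →
          ∀ φ : S.testFunctions 0, (IsFunction φ fun x => pointPow x m f) →
            IsFunction (Θ φ) fun x => wick x m f := by
  refine ⟨hA.nonempty_eigenbasis, fun S => ⟨?_, genWick_trace, ?_⟩⟩
  · intro r hr κ _ β hβ hβ'
    have hβ0 : 0 ≤ β := le_trans (by positivity) hβ
    obtain ⟨Ξ, hΞ⟩ := exists_integralKernelOperator hr κ hβ hβ'
    obtain ⟨T, hT⟩ := exists_exp hr hβ hβ' hΞ (t := -(1 / 2 : ℂ)) (by norm_num)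
    obtain ⟨D, U, U', hD, hU, hUU', hU'U⟩ := exists_trace_exp (S := S) hβ0 hβ'
    refine ⟨Ξ, T, hΞ, hT, fun m f hf => ?_⟩
    -- The monomial has power series `S.emb β m f`, so its unique Wick representative is `U' (S.emb
    -- β m f)`.
    have hfun : ∀ φ : S.testFunctions β,
        (IsFunction φ fun x => pointPow x m f) ↔ φ = U' (S.emb β m f) := fun φ =>
      isFunction_iff_eq hβ0 hD hU hUU' hU'U fun x => evalAt_emb hβ0 x hf
    refine ⟨⟨_, (hfun _).2 rfl, fun φ hφ => (hfun φ).1 hφ⟩, fun φ hφ => ?_⟩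
    rw [isFunction_iff hβ0 hD hU]
    intro x
    -- Commuting `U` past `T` cancels it against `U'`; what remains is the power series of `T (S.emb
    -- β m f)`.
    rw [(hfun φ).1 hφ, hU.commute hD hΞ hT hβ', hUU', evalAt_exp_emb hβ0 hr hΞ hT]
  · obtain ⟨D, U, U', hD, hU, hUU', hU'U⟩ := exists_trace_exp (S := S) le_rfl one_pos
    refine ⟨D, U, hD, hU, (isRenormalization_iff hD hU hUU' hU'U).2 rfl,
      fun Θ' => (isRenormalization_iff hD hU hUU' hU'U).1, fun m f hf φ hφ => ?_⟩
    rw [isFunction_iff_eq le_rfl hD hU hUU' hU'U fun x => evalAt_emb le_rfl x hf] at hφ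
    rw [hφ, hUU', isFunction_iff le_rfl hD hU]
    intro x
    rw [evalAt_exp_emb le_rfl one_le_two hD hU, genWick_trace]
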